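/- For $n\ge 0$ let $\mathrm{Br}_n$ be the braid group on $n$ strands with its band generators $a_{ij}$, $1\le i<j\le n$, i.e. the group with generators $a_{ij}$ and relations $a_{ij}a_{kl}=a_{kl}a_{ij}$ whenever $i<j$, $k<l$ and $(k-i)(k-j)(l-i)(l-j)>0$, and $a_{ij}a_{ik}=a_{jk}a_{ij}=a_{ik}a_{jk}$ whenever $i<j<k$. Let $\pi:\mathrm{Br}_n\to S_n$ be the natural homomorphism $a_{ij}\mapsto(i\,j)$. Let $M=(m_{ij})$ be a symmetric $n\times n$ matrix with $m_{ij}\in\{1,2\}$ for all $i\ne j$ (the diagonal entries play no role), such that for pairwise distinct $i,j,k$, if $m_{ij}=m_{jk}=1$ then $m_{ik}=1$. Let $b_{ij}=a_{ij}^{m_{ij}}$ and let $E_M\subset\mathrm{Br}_n$ be the subgroup generated by all $b_{ij}$, $1\le i<j\le n$. We also write $b_{ji}=b_{ij}$. 1. $E_M$ is presented by the generators $b_{ij}$, $1\le i<j\le n$, and the following relations; that is, mapping each abstract generator to the element $b_{ij}$ of $\mathrm{Br}_n$ induces an isomorphism from the presented group onto $E_M$: i) $b_{il}b_{jk}=b_{jk}b_{il}$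 for $i<j<k<l$ or $j<k<i<l$; ii) $b_{jl}\,c_{kl}b_{ik}c_{kl}^{-1}=c_{kl}b_{ik}c_{kl}^{-1}\,b_{jl}$ for $i<j<k<l$, where $c_{kl}=b_{kl}$ if $m_{kl}=2$ and $c_{kl}=b_{kl}^2$ if $m_{kl}=1$ (so $c_{kl}$ represents $a_{kl}^2$); iii) $b_{ij}b_{ik}=b_{jk}b_{ij}$ and $b_{ij}b_{ik}b_{jk}=b_{ik}b_{jk}b_{ij}$ for $i,j,k$ in cyclic order (i.e. $i<j<k$ or $j<k<i$ or $k<i<j$) with $m_{ij}=1$, $m_{ik}=m_{jk}=2$; iv) $b_{ij}b_{ik}b_{jk}=b_{jk}b_{ij}b_{ik}=b_{ik}b_{jk}b_{ij}$ for $i<j<k$ with $m_{ij}=m_{ik}=m_{jk}=2$; v) $b_{ij}b_{ik}=b_{jk}b_{ij}=b_{ik}b_{jk}$ for $i<j<k$ with $m_{ij}=m_{ik}=m_{jk}=1$. 2. The relation $i\sim j:\Leftrightarrow i=j$ or $m_{ij}=1$ is an equivalence relation on $\{1,\dots,n\}$, and $E_M$ is the group of all braids $\beta\in\mathrm{Br}_n$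 whose permutation preserves each of its classes, i.e. $\pi(\beta)(i)\sim i$ for all $i$. 3. In particular, if $m_{ij}=2$ for all $i\neq j$, then $E_M$ is the pure braid group $\ker\pi$. -/

import Mathlib

namespace BandBraid

/-- Index set of the generators: pairs `i < j` in `Fin n` (the strands `1, …, n` are numbered
`0, …, n - 1`). -/
abbrev Band (n : ℕ) : Type := {p : Fin n × Fin n // p.1 < p.2}

/-- The letter with unordered index `{i, j}`, so `letter i j = letter j i`. The value on the
diagonal is never used. -/
def letter {n : ℕ} (i j : Fin n) : FreeGroup (Band n) :=
  if h : i < j then FreeGroup.of ⟨(i, j), h⟩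
  else if h : j < i then FreeGroup.of ⟨(j, i), h⟩
  else 1

/-- The set of relators `u * v⁻¹` of a family of relations `u = v`. -/
def relators {α : Type*} (R : FreeGroup α → FreeGroup α → Prop) : Set (FreeGroup α) :=
  {r | ∃ u v, R u v ∧ r = u * v⁻¹}

/-- The relations of the dual (Birman–Ko–Lee) presentation of the braid group. -/
inductive BKLRel (n : ℕ) : FreeGroup (Band n) → FreeGroup (Band n) → Prop
  | comm (i j k l : Fin n) (hij : i < j) (hkl : k < l)
      (h : 0 < ((k : ℤ) - (i : ℤ)) * ((k : ℤ) - (j : ℤ)) * ((l : ℤ) - (i : ℤ)) *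
        ((l : ℤ) - (j : ℤ))) :
      BKLRel n (letter i j * letter k l) (letter k l * letter i j)
  | tri₁ (i j k : Fin n) (hij : i < j) (hjk : j < k) :
      BKLRel n (letter i j * letter i k) (letter j k * letter i j)
  | tri₂ (i j k : Fin n) (hij : i < j) (hjk : j < k) :
      BKLRel n (letter j k * letter i j) (letter i k * letter j k)

/-- The braid group on `n` strands. -/
abbrev BraidGroup (n : ℕ) : Type := PresentedGroup (relators (BKLRel n))

/-- The band generator `a_ij` (`= a_ji`). -/
def band {n : ℕ} (i j : Fin n) : BraidGroup n :=
  PresentedGroup.mk (relators (BKLRel n)) (letter i j)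

/-- The subgroup `E_M` of the braid group generated by the powers `a_ij ^ m_ij`, `i < j`. -/
def E {n : ℕ} (M : Matrix (Fin n) (Fin n) ℕ) : Subgroup (BraidGroup n) :=
  Subgroup.closure {x | ∃ i j : Fin n, i < j ∧ x = band i j ^ M i j}

/-- The word in the generators `b_ij` that stands for `a_kl ^ 2`: it is `b_kl` if `m_kl = 2` and
`b_kl ^ 2` if `m_kl = 1`. -/
def sqWord {n : ℕ} (M : Matrix (Fin n) (Fin n) ℕ) (k l : Fin n) : FreeGroup (Band n) :=
  if M k l = 2 then letter k l else letter k l ^ 2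

/-- `i, j, k` are pairwise distinct and in cyclic order. -/
def CyclicOrder {n : ℕ} (i j k : Fin n) : Prop :=
  (i < j ∧ j < k) ∨ (j < k ∧ k < i) ∨ (k < i ∧ i < j)

/-- The defining relations between the generators `b_ij`, here written `letter i j`. -/
inductive ERel {n : ℕ} (M : Matrix (Fin n) (Fin n) ℕ) :
    FreeGroup (Band n) → FreeGroup (Band n) → Prop
  | comm (i j k l : Fin n) (h : (i < j ∧ j < k ∧ k < l) ∨ (j < k ∧ k < i ∧ i < l)) :
      ERel M (letter i l * letter j k) (letter j k * letter i l)
  | conj (i j k l : Fin n) (hij : i < j) (hjk : j < k) (hkl : k < l) :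
      ERel M (letter j l * (sqWord M k l * letter i k * (sqWord M k l)⁻¹))
        (sqWord M k l * letter i k * (sqWord M k l)⁻¹ * letter j l)
  | mixed₁ (i j k : Fin n) (h : CyclicOrder i j k)
      (hij : M i j = 1) (hik : M i k = 2) (hjk : M j k = 2) :
      ERel M (letter i j * letter i k) (letter j k * letter i j)
  | mixed₂ (i j k : Fin n) (h : CyclicOrder i j k)
      (hij : M i j = 1) (hik : M i k = 2) (hjk : M j k = 2) :
      ERel M (letter i j * letter i k * letter j k) (letter i k * letter j k * letter i j)
  | two₁ (i j k : Fin n) (h : i < j ∧ j < k)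
      (hij : M i j = 2) (hik : M i k = 2) (hjk : M j k = 2) :
      ERel M (letter i j * letter i k * letter j k) (letter j k * letter i j * letter i k)
  | two₂ (i j k : Fin n) (h : i < j ∧ j < k)
      (hij : M i j = 2) (hik : M i k = 2) (hjk : M j k = 2) :
      ERel M (letter j k * letter i j * letter i k) (letter i k * letter j k * letter i j)
  | one₁ (i j k : Fin n) (h : i < j ∧ j < k)
      (hij : M i j = 1) (hik : M i k = 1) (hjk : M j k = 1) :
      ERel M (letter i j * letter i k) (letter j k * letter i j)
  | one₂ (i j k : Fin n) (h : i < j ∧ j < k)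
      (hij : M i j = 1) (hik : M i k = 1) (hjk : M j k = 1) :
      ERel M (letter j k * letter i j) (letter i k * letter j k)

/-- The group with generators `b_ij`, `i < j`, and the above relations. -/
abbrev EPresented {n : ℕ} (M : Matrix (Fin n) (Fin n) ℕ) : Type :=
  PresentedGroup (relators (ERel M))

/-- The transposition attached to a generator. -/
def bandSwap {n : ℕ} (p : Band n) : Equiv.Perm (Fin n) := Equiv.swap p.1.1 p.1.2

theorem lift_letter {n : ℕ} (i j : Fin n) :
    FreeGroup.lift bandSwap (letter i j) = Equiv.swap i j := by
  unfold letter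
  split_ifs with h h'
  · simp [bandSwap]
  · simp [bandSwap, Equiv.swap_comm]
  · have : i = j := le_antisymm (not_lt.mp h') (not_lt.mp h)
    subst this
    rw [map_one, Equiv.swap_self]
    rfl

theorem lift_relator {n : ℕ} :
    ∀ r ∈ relators (BKLRel n), FreeGroup.lift bandSwap r = 1 := by
  rintro r ⟨u, v, huv, rfl⟩
  rw [map_mul, map_inv, mul_inv_eq_one]
  cases huv with
  | comm i j k l hij hkl h =>
    have h1 : k ≠ i := by rintro rfl; simp at h
    have h2 : k ≠ j := by rintro rfl; simp at h
    have h3 : l ≠ i := by rintro rfl; simp at h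
    have h4 : l ≠ j := by rintro rfl; simp at h
    simp only [map_mul, lift_letter]
    rw [Equiv.mul_swap_eq_swap_mul, Equiv.swap_apply_of_ne_of_ne h1 h2,
      Equiv.swap_apply_of_ne_of_ne h3 h4]
  | tri₁ i j k hij hjk =>
    simp only [map_mul, lift_letter]
    rw [Equiv.mul_swap_eq_swap_mul, Equiv.swap_apply_left,
      Equiv.swap_apply_of_ne_of_ne (hij.trans hjk).ne' hjk.ne']
  | tri₂ i j k hij hjk =>
    simp only [map_mul, lift_letter]
    rw [Equiv.mul_swap_eq_swap_mul, Equiv.swap_apply_left,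
      Equiv.swap_apply_of_ne_of_ne hij.ne (hij.trans hjk).ne]

/-- The natural homomorphism from the braid group to the symmetric group, `a_ij ↦ (i j)`. -/
def permHom (n : ℕ) : BraidGroup n →* Equiv.Perm (Fin n) :=
  PresentedGroup.toGroup lift_relator

/-- The braids whose permutation maps every block of the partition `P` (given as an equivalence
relation) to itself. -/
def partitionBraids {n : ℕ} (P : Setoid (Fin n)) : Subgroup (BraidGroup n) where
  carrier := {β | ∀ i, P (permHom n β i) i}
  one_mem' i := by
    rw [map_one]
    exact P.refl i
  mul_mem' {β γ} hβ hγ i := by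
    rw [map_mul, Equiv.Perm.mul_apply]
    exact P.trans (hβ _) (hγ i)
  inv_mem' {β} hβ i := by
    have h := hβ ((permHom n β)⁻¹ i)
    rw [← Equiv.Perm.mul_apply, mul_inv_cancel, Equiv.Perm.one_apply] at h
    rw [map_inv]
    exact P.symm h

end BandBraid

/-! Let `G` be the group presented by the generators `b_ij`, mapped to the braid group. The
relations hold there, so only injectivity is at stake. An element of the kernel has trivial
permutation, and two independent arguments show that it is trivial.

Let `N ≤ G` be generated by the words for the full twists `a_ij ^ 2`. The relations make `N` normal.
In `G ⧸ N` the generators with exponent 2 vanish, and those with exponent 1 become involutions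
multiplying like transpositions. Coset enumeration shows that such a group embeds into the symmetric
group, so elements with trivial permutation lie in `N` (`mem_fullTwists_of_map_eq_one`).

The generators of `N` satisfy the pure braid relations, and these alone force injectivity on `N`
(`PureRel.eq_one_of_map_eq_one`). They allow combing: an element splits as `k * h`, where `k` is a
product of twists of the last strand `m` and `h` does not involve `m`. If the image is trivial, it
acts trivially on tuples of group elements in the Hurwitz action. Putting `1` at position `m`
silences `k`, so `h` acts trivially, and induction gives `h = 1`. Then `k` is a word in the twists
of `m`, and a test tuple in a wreath product over a free group detects every nontrivial word.

Applied to the braid group itself with all exponents 1, the first argument says that the squares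
`a_ij ^ 2` generate the pure braids. Hence `E_M` contains `ker π`, and comparing `E_M` with the
partition braids reduces to permutations. -/

namespace BandBraid

/-! ### The Hurwitz action of the braid group -/

/-- The action of a band generator on tuples of elements of a group. -/
def hurwitzFun {n : ℕ} {H : Type*} [Group H] (i j : Fin n) (X : Fin n → H) : Fin n → H := fun m =>
  if m = i then (X i)⁻¹ * X j * X i
  else if m = j then X i
  else if i < m ∧ m < j then (X i)⁻¹ * X j * X m * ((X i)⁻¹ * X j)⁻¹
  else X m

/-- The inverse of `hurwitzFun`. -/
def hurwitzInv {n : ℕ} {H : Type*} [Group H] (i j : Fin n) (X : Fin n → H) : Fin n → H := fun m =>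
  if m = i then X j
  else if m = j then X j * X i * (X j)⁻¹
  else if i < m ∧ m < j then X j * (X i)⁻¹ * X m * (X j * (X i)⁻¹)⁻¹
  else X m

section
variable {n : ℕ} {H : Type*} [Group H]

theorem hurwitzInv_hurwitzFun {i j : Fin n} (h : i < j) (X : Fin n → H) :
    hurwitzInv i j (hurwitzFun i j X) = X := by
  funext m
  have h1 := h.ne
  have h2 := h.ne'
  unfold hurwitzInv hurwitzFun
  split_ifs <;> simp_all [mul_assoc]

theorem hurwitzFun_hurwitzInv {i j : Fin n} (h : i < j) (X : Fin n → H) :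
    hurwitzFun i j (hurwitzInv i j X) = X := by
  funext m
  have h1 := h.ne
  have h2 := h.ne'
  unfold hurwitzInv hurwitzFun
  split_ifs <;> simp_all [mul_assoc]

/-- The permutation of tuples given by a band generator. -/
def hurwitzPerm (H : Type*) [Group H] (p : Band n) : Equiv.Perm (Fin n → H) where
  toFun := hurwitzFun p.1.1 p.1.2
  invFun := hurwitzInv p.1.1 p.1.2
  left_inv := hurwitzInv_hurwitzFun p.2
  right_inv := hurwitzFun_hurwitzInv p.2

theorem hurwitzFun_comm_of_disjoint {i j k l : Fin n} (hij : i < j) (hjk : j < k) (hkl : k < l)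
    (X : Fin n → H) :
    hurwitzFun i j (hurwitzFun k l X) = hurwitzFun k l (hurwitzFun i j X) := by
  funext m
  unfold hurwitzFun
  grind

theorem hurwitzFun_comm_of_nested {i j k l : Fin n} (hij : i < j) (hjk : j < k) (hkl : k < l)
    (X : Fin n → H) :
    hurwitzFun i l (hurwitzFun j k X) = hurwitzFun j k (hurwitzFun i l X) := by
  funext m
  have h1 : i < k := hij.trans hjk
  have h2 : i < l := h1.trans hkl
  have h3 : j < l := hjk.trans hkl
  unfold hurwitzFun
  rcases lt_trichotomy m i with h | h | h <;> rcases lt_trichotomy m j with h' | h' | h' <;>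
  rcases lt_trichotomy m k with h'' | h'' | h'' <;> rcases lt_trichotomy m l with h''' | h''' | h''' <;>
  first | omega | simp [*, mul_assoc, ne_of_lt, ne_of_gt, lt_asymm]

theorem hurwitzFun_tri₁ {i j k : Fin n} (hij : i < j) (hjk : j < k) (X : Fin n → H) :
    hurwitzFun i j (hurwitzFun i k X) = hurwitzFun j k (hurwitzFun i j X) := by
  funext m
  have h1 : i < k := hij.trans hjk
  unfold hurwitzFun
  rcases lt_trichotomy m i with h | h | h <;> rcases lt_trichotomy m j with h' | h' | h' <;>
  rcases lt_trichotomy m k with h'' | h'' | h'' <;>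
  first | omega | simp [*, mul_assoc, ne_of_lt, ne_of_gt, lt_asymm]

theorem hurwitzFun_tri₂ {i j k : Fin n} (hij : i < j) (hjk : j < k) (X : Fin n → H) :
    hurwitzFun j k (hurwitzFun i j X) = hurwitzFun i k (hurwitzFun j k X) := by
  funext m
  have h1 : i < k := hij.trans hjk
  unfold hurwitzFun
  rcases lt_trichotomy m i with h | h | h <;> rcases lt_trichotomy m j with h' | h' | h' <;>
  rcases lt_trichotomy m k with h'' | h'' | h'' <;>
  first | omega | simp [*, mul_assoc, ne_of_lt, ne_of_gt, lt_asymm]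

theorem lift_hurwitzPerm_letter {i j : Fin n} (h : i < j) (X : Fin n → H) :
    FreeGroup.lift (hurwitzPerm H) (letter i j) X = hurwitzFun i j X := by
  simp [letter, h, hurwitzPerm]

theorem lift_hurwitzPerm_relator :
    ∀ r ∈ relators (BKLRel n), FreeGroup.lift (hurwitzPerm H) r = 1 := by
  rintro r ⟨u, v, huv, rfl⟩
  rw [map_mul, map_inv, mul_inv_eq_one]
  ext1 X
  cases huv with
  | comm i j k l hij hkl h =>
    -- The positive product says that the pairs do not cross: they are disjoint or nested. For
    -- crossing pairs exactly one or three of the four factors are negative.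
    have key : j < k ∨ l < i ∨ (i < k ∧ l < j) ∨ (k < i ∧ j < l) := by
      have hij' : (i : ℤ) < j := by exact_mod_cast hij
      have hkl' : (k : ℤ) < l := by exact_mod_cast hkl
      have h1 : k ≠ i := by rintro rfl; simp at h
      have h2 : k ≠ j := by rintro rfl; simp at h
      have h3 : l ≠ i := by rintro rfl; simp at h
      have h4 : l ≠ j := by rintro rfl; simp at h
      by_contra hc
      push Not at hc
      obtain ⟨c1, c2, c3, c4⟩ := hc
      have c1' : (k : ℤ) < j := by exact_mod_cast lt_of_le_of_ne c1 h2
      have c2' : (i : ℤ) < l := by exact_mod_cast lt_of_le_of_ne c2 h3.symm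
      rcases lt_or_gt_of_ne h1 with hki | hki
      · have c5 : (l : ℤ) < j := by exact_mod_cast lt_of_le_of_ne (c4 hki) h4
        have c6 : (k : ℤ) < i := by exact_mod_cast hki
        have e1 := mul_pos (mul_pos (sub_pos.2 c6) (sub_pos.2 c1'))
          (mul_pos (sub_pos.2 c2') (sub_pos.2 c5))
        nlinarith
      · have c5 : (j : ℤ) < l := by exact_mod_cast lt_of_le_of_ne (c3 hki) h4.symm
        have c6 : (i : ℤ) < k := by exact_mod_cast hki
        have e1 := mul_pos (mul_pos (sub_pos.2 c6) (sub_pos.2 c1'))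
          (mul_pos (sub_pos.2 c2') (sub_pos.2 c5))
        nlinarith
    simp only [map_mul, Equiv.Perm.mul_apply, lift_hurwitzPerm_letter hij,
      lift_hurwitzPerm_letter hkl]
    rcases key with h | h | ⟨h, h'⟩ | ⟨h, h'⟩
    · exact hurwitzFun_comm_of_disjoint hij h hkl X
    · exact (hurwitzFun_comm_of_disjoint hkl h hij X).symm
    · exact hurwitzFun_comm_of_nested h hkl h' X
    · exact (hurwitzFun_comm_of_nested h hij h' X).symm
  | tri₁ i j k hij hjk =>
    simp only [map_mul, Equiv.Perm.mul_apply, lift_hurwitzPerm_letter hij,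
      lift_hurwitzPerm_letter hjk, lift_hurwitzPerm_letter (hij.trans hjk)]
    exact hurwitzFun_tri₁ hij hjk X
  | tri₂ i j k hij hjk =>
    simp only [map_mul, Equiv.Perm.mul_apply, lift_hurwitzPerm_letter hij,
      lift_hurwitzPerm_letter hjk, lift_hurwitzPerm_letter (hij.trans hjk)]
    exact hurwitzFun_tri₂ hij hjk X

end

/-- The Hurwitz action of the braid group on `n`-tuples of elements of a group. -/
def hurwitz (n : ℕ) (H : Type*) [Group H] : BraidGroup n →* Equiv.Perm (Fin n → H) :=
  PresentedGroup.toGroup lift_hurwitzPerm_relator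

section
variable {n : ℕ} {H : Type*} [Group H]

theorem hurwitz_band {i j : Fin n} (h : i < j) (X : Fin n → H) :
    hurwitz n H (band i j) X = hurwitzFun i j X := by
  rw [← lift_hurwitzPerm_letter h]
  rfl

theorem hurwitz_band_sq {i j : Fin n} (h : i < j) (X : Fin n → H) :
    hurwitz n H (band i j ^ 2) X = hurwitzFun i j (hurwitzFun i j X) := by
  rw [pow_two, map_mul, Equiv.Perm.mul_apply, hurwitz_band h, hurwitz_band h]

theorem closure_band (n : ℕ) :
    Subgroup.closure {x : BraidGroup n | ∃ i j, i < j ∧ x = band i j} = ⊤ := by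
  rw [eq_top_iff, ← PresentedGroup.closure_range_of]
  apply Subgroup.closure_mono
  rintro _ ⟨⟨⟨i, j⟩, h⟩, rfl⟩
  refine ⟨i, j, h, ?_⟩
  simp only [band, letter, dif_pos (show i < j from h)]
  rfl

/-- The new entries are group words in the old ones, so the action is natural in the group. This
allows a tuple in the wreath product to be projected to its free quotient. -/
theorem hurwitz_comp {H' : Type*} [Group H'] (p : H →* H') (β : BraidGroup n) (X : Fin n → H) :
    hurwitz n H' β (p ∘ X) = p ∘ hurwitz n H β X := by
  have hβ : β ∈ Subgroup.closure {x : BraidGroup n | ∃ i j, i < j ∧ x = band i j} := by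
    rw [closure_band]; trivial
  induction hβ using Subgroup.closure_induction generalizing X with
  | mem x hx =>
    obtain ⟨i, j, h, rfl⟩ := hx
    rw [hurwitz_band h, hurwitz_band h]
    funext m
    simp only [hurwitzFun, Function.comp_apply]
    split_ifs <;> simp
  | one => simp
  | mul x y _ _ hx hy => simp only [map_mul, Equiv.Perm.mul_apply, hx, hy]
  | inv x _ hx =>
    rw [map_inv, map_inv, Equiv.Perm.inv_eq_iff_eq, hx, ← Equiv.Perm.mul_apply, mul_inv_cancel,
      Equiv.Perm.one_apply]

/-- A full twist with a strand that carries `1` acts trivially. -/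
theorem hurwitz_band_sq_of_eq_one {i m : Fin n} (h : i < m) (X : Fin n → H) (hX : X m = 1) :
    hurwitz n H (band i m ^ 2) X = X := by
  rw [hurwitz_band_sq h]
  have h1 := h.ne
  have h2 := h.ne'
  funext k
  unfold hurwitzFun
  split_ifs <;> simp_all [mul_assoc]

/-- Twisting strands below `m` neither affects nor uses the entry at `m`. -/
theorem hurwitz_band_sq_update {i j m : Fin n} (h : i < j) (hm : j < m) (X : Fin n → H) (a : H) :
    hurwitz n H (band i j ^ 2) (Function.update X m a) =
      Function.update (hurwitz n H (band i j ^ 2) X) m a := by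
  rw [hurwitz_band_sq h, hurwitz_band_sq h]
  have h1 := hm.ne
  have h2 := hm.ne'
  have h3 := (h.trans hm).ne
  have h4 := (h.trans hm).ne'
  funext k
  by_cases hk : k = m
  · subst hk
    simp [hurwitzFun, *, hm.not_gt]
  · simp [hurwitzFun, *]

end
-- Combing and the pure braid relations
/-- The defining relations of the pure braid group, for a family `A i j`, `i < j`. -/
structure PureRel {n : ℕ} {G : Type*} [Group G] (A : Fin n → Fin n → G) : Prop where
  comm : ∀ {i j k l}, (i < j ∧ j < k ∧ k < l) ∨ (j < k ∧ k < i ∧ i < l) → Commute (A i l) (A j k)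
  conj : ∀ {i j k l}, i < j → j < k → k < l → Commute (A j l) (A k l * A i k * (A k l)⁻¹)
  tri₁ : ∀ {i j k}, i < j → j < k → A i j * A i k * A j k = A j k * A i j * A i k
  tri₂ : ∀ {i j k}, i < j → j < k → A j k * A i j * A i k = A i k * A j k * A i j

/-- The subgroup generated by the `A i j` with `i < j < m`. -/
def lowerTwists {n : ℕ} {G : Type*} [Group G] (A : Fin n → Fin n → G) (m : ℕ) : Subgroup G :=
  Subgroup.closure {x | ∃ i j : Fin n, i < j ∧ j.val < m ∧ x = A i j}

/-- The subgroup generated by the `A i m` with `i < m`. -/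
def strandTwists {n : ℕ} {G : Type*} [Group G] (A : Fin n → Fin n → G) (m : Fin n) : Subgroup G :=
  Subgroup.closure {x | ∃ i, i < m ∧ x = A i m}

section
variable {n : ℕ} {G : Type*} [Group G] {A : Fin n → Fin n → G}

theorem mem_strandTwists {i m : Fin n} (h : i < m) : A i m ∈ strandTwists A m :=
  Subgroup.subset_closure ⟨i, h, rfl⟩

/-- If conjugation by `g` maps generators into the subgroup they generate, then it maps this subgroup
into itself. -/
theorem conj_mem_closure {S : Set G} {g : G} (h : ∀ s ∈ S, g * s * g⁻¹ ∈ Subgroup.closure S)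
    {x : G} (hx : x ∈ Subgroup.closure S) : g * x * g⁻¹ ∈ Subgroup.closure S := by
  have : Subgroup.closure S ≤ (Subgroup.closure S).comap (MulAut.conj g).toMonoidHom := by
    rw [Subgroup.closure_le]
    intro s hs
    exact h s hs
  exact this hx

/-- The triangle relations say that `A i j` commutes with `A i m * A j m` and determine its
conjugation action on both factors. For `k` outside `[i, j]` the twist `A k m` commutes with `A i
j`; for `i < k < j` its conjugate by `(A j m)⁻¹` does, which reduces to the case of `A j m`. -/
theorem PureRel.conj_strandTwists (hA : PureRel A) {i j m : Fin n} (hij : i < j) (hjm : j < m) :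
    (∀ x ∈ strandTwists A m, A i j * x * (A i j)⁻¹ ∈ strandTwists A m) ∧
      ∀ x ∈ strandTwists A m, (A i j)⁻¹ * x * A i j ∈ strandTwists A m := by
  have hp : A i m ∈ strandTwists A m := mem_strandTwists (hij.trans hjm)
  have hq : A j m ∈ strandTwists A m := mem_strandTwists hjm
  have h1 := hA.tri₁ hij hjm
  have h2 := hA.tri₂ hij hjm
  have e1 : A i j * A i m * (A i j)⁻¹ = (A j m)⁻¹ * A i m * A j m := by
    rw [mul_inv_eq_iff_eq_mul, mul_assoc, mul_assoc, eq_inv_mul_iff_mul_eq, ← mul_assoc,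
      ← mul_assoc, h2]
  have e1' : (A i j)⁻¹ * A j m * A i j = A i m * A j m * (A i m)⁻¹ := by
    rw [eq_mul_inv_iff_mul_eq, mul_assoc, mul_assoc, inv_mul_eq_iff_eq_mul, ← mul_assoc,
      ← mul_assoc, h1]
  have e2 : A i j * (A i m * A j m) * (A i j)⁻¹ = A i m * A j m := by
    rw [mul_inv_eq_iff_eq_mul, ← mul_assoc, h1, h2]
  have e2' : (A i j)⁻¹ * (A i m * A j m) * A i j = A i m * A j m := by
    rw [mul_assoc, inv_mul_eq_iff_eq_mul, ← h2, ← h1, mul_assoc]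
  have q1 : A i j * A j m * (A i j)⁻¹ ∈ strandTwists A m := by
    have : A i j * A j m * (A i j)⁻¹ =
        (A i j * A i m * (A i j)⁻¹)⁻¹ * (A i j * (A i m * A j m) * (A i j)⁻¹) := by group
    rw [this, e1, e2]
    exact mul_mem (inv_mem (mul_mem (mul_mem (inv_mem hq) hp) hq)) (mul_mem hp hq)
  have p1 : A i j * A i m * (A i j)⁻¹ ∈ strandTwists A m := by
    rw [e1]; exact mul_mem (mul_mem (inv_mem hq) hp) hq
  have q2 : (A i j)⁻¹ * A j m * A i j ∈ strandTwists A m := by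
    rw [e1']; exact mul_mem (mul_mem hp hq) (inv_mem hp)
  have p2 : (A i j)⁻¹ * A i m * A i j ∈ strandTwists A m := by
    have : (A i j)⁻¹ * A i m * A i j =
        ((A i j)⁻¹ * (A i m * A j m) * A i j) * ((A i j)⁻¹ * A j m * A i j)⁻¹ := by group
    rw [this, e2']
    exact mul_mem (mul_mem hp hq) (inv_mem q2)
  have main : ∀ k, k < m → A i j * A k m * (A i j)⁻¹ ∈ strandTwists A m ∧
      (A i j)⁻¹ * A k m * A i j ∈ strandTwists A m := by
    intro k hk
    have of_comm : Commute (A k m) (A i j) → A i j * A k m * (A i j)⁻¹ ∈ strandTwists A m ∧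
      (A i j)⁻¹ * A k m * A i j ∈ strandTwists A m := by
      intro h
      rw [h.symm.eq, mul_inv_cancel_right, mul_assoc, h.eq, inv_mul_cancel_left]
      exact ⟨mem_strandTwists hk, mem_strandTwists hk⟩
    rcases lt_trichotomy k i with h | rfl | h
    · exact of_comm (hA.comm (Or.inl ⟨h, hij, hjm⟩))
    · exact ⟨p1, p2⟩
    rcases lt_trichotomy k j with h' | rfl | h'
    · have hk' : A k m ∈ strandTwists A m := mem_strandTwists hk
      have hc : Commute ((A j m)⁻¹ * A k m * A j m) (A i j) := by
        have := hA.conj h h' hjm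
        have e : A i j = (A j m)⁻¹ * (A j m * A i j * (A j m)⁻¹) * A j m := by group
        rw [e]
        have := this.conj (A j m)⁻¹
        simpa using this
      have hy : (A j m)⁻¹ * A k m * A j m ∈ strandTwists A m :=
        mul_mem (mul_mem (inv_mem hq) hk') hq
      constructor
      · have e : A i j * A k m * (A i j)⁻¹ = (A i j * A j m * (A i j)⁻¹) *
            (A i j * ((A j m)⁻¹ * A k m * A j m) * (A i j)⁻¹) *
            (A i j * A j m * (A i j)⁻¹)⁻¹ := by group
        rw [e, hc.symm.eq, mul_inv_cancel_right]
        exact mul_mem (mul_mem q1 hy) (inv_mem q1)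
      · have e : (A i j)⁻¹ * A k m * A i j = ((A i j)⁻¹ * A j m * A i j) *
            ((A i j)⁻¹ * (((A j m)⁻¹ * A k m * A j m) * A i j)) *
            ((A i j)⁻¹ * A j m * A i j)⁻¹ := by group
        rw [e, hc.eq, inv_mul_cancel_left]
        exact mul_mem (mul_mem q2 hy) (inv_mem q2)
    · exact ⟨q1, q2⟩
    · exact of_comm (hA.comm (Or.inr ⟨hij, h', hk⟩))
  constructor
  · intro x hx
    refine conj_mem_closure ?_ hx
    rintro _ ⟨k, hk, rfl⟩
    exact (main k hk).1
  · intro x hx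
    have := conj_mem_closure (g := (A i j)⁻¹) ?_ hx
    · rwa [inv_inv] at this
    rintro _ ⟨k, hk, rfl⟩
    rw [inv_inv]
    exact (main k hk).2

theorem PureRel.lowerTwists_conj (hA : PureRel A) (m : Fin n) {h : G} (hh : h ∈ lowerTwists A m) :
    ∀ x ∈ strandTwists A m, h * x * h⁻¹ ∈ strandTwists A m := by
  -- Both directions are carried along: mapping a subgroup into itself under conjugation by `h` says
  -- nothing about `h⁻¹`.
  suffices (∀ x ∈ strandTwists A m, h * x * h⁻¹ ∈ strandTwists A m) ∧
      ∀ x ∈ strandTwists A m, h⁻¹ * x * h ∈ strandTwists A m from this.1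
  induction hh using Subgroup.closure_induction with
  | mem y hy =>
    obtain ⟨i, j, hij, hjm, rfl⟩ := hy
    exact hA.conj_strandTwists hij hjm
  | one => simp
  | mul a b _ _ ha hb =>
    refine ⟨fun x hx => ?_, fun x hx => ?_⟩
    · convert ha.1 _ (hb.1 x hx) using 1; group
    · convert hb.2 _ (ha.2 x hx) using 1; group
  | inv a _ ha => exact ⟨by simpa using ha.2, by simpa using ha.1⟩

/-- Every element of `lowerTwists A (m + 1)` combs into a twist of the strand `m` and a part that
does not involve `m`. -/
theorem PureRel.exists_comb (hA : PureRel A) (m : Fin n) {x : G}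
    (hx : x ∈ lowerTwists A (m + 1)) :
    ∃ k ∈ strandTwists A m, ∃ h ∈ lowerTwists A m, x = k * h := by
  induction hx using Subgroup.closure_induction with
  | mem y hy =>
    obtain ⟨i, j, hij, hjm, rfl⟩ := hy
    rcases (Nat.lt_succ_iff.1 hjm).lt_or_eq with h | h
    · exact ⟨1, one_mem _, A i j, Subgroup.subset_closure ⟨i, j, hij, h, rfl⟩, by simp⟩
    · obtain rfl : j = m := Fin.ext h
      exact ⟨A i j, mem_strandTwists hij, 1, one_mem _, by simp⟩
  | one => exact ⟨1, one_mem _, 1, one_mem _, by simp⟩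
  | mul a b _ _ ha hb =>
    obtain ⟨k, hk, h, hh, rfl⟩ := ha
    obtain ⟨k', hk', h', hh', rfl⟩ := hb
    exact ⟨k * (h * k' * h⁻¹), mul_mem hk (hA.lowerTwists_conj m hh _ hk'), h * h',
      mul_mem hh hh', by group⟩
  | inv a _ ha =>
    obtain ⟨k, hk, h, hh, rfl⟩ := ha
    exact ⟨h⁻¹ * k⁻¹ * h⁻¹⁻¹, hA.lowerTwists_conj m (inv_mem hh) _ (inv_mem hk), h⁻¹,
      inv_mem hh, by group⟩

variable {φ : G →* BraidGroup n}

theorem hurwitz_strandTwists_of_eq_one (hφ : ∀ i j, i < j → φ (A i j) = band i j ^ 2)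
    {m : Fin n} {k : G} (hk : k ∈ strandTwists A m) {H : Type*} [Group H] (X : Fin n → H)
    (hX : X m = 1) : hurwitz n H (φ k) X = X := by
  induction hk using Subgroup.closure_induction with
  | mem y hy =>
    obtain ⟨i, hi, rfl⟩ := hy
    rw [hφ i m hi, hurwitz_band_sq_of_eq_one hi X hX]
  | one => simp
  | mul a b _ _ ha hb => rw [map_mul, map_mul, Equiv.Perm.mul_apply, hb, ha]
  | inv a _ ha => rw [map_inv, map_inv, Equiv.Perm.inv_eq_iff_eq, ha]

theorem hurwitz_lowerTwists_update (hφ : ∀ i j, i < j → φ (A i j) = band i j ^ 2)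
    {m : Fin n} {h : G} (hh : h ∈ lowerTwists A m) {H : Type*} [Group H] (X : Fin n → H) (a : H) :
    hurwitz n H (φ h) (Function.update X m a) = Function.update (hurwitz n H (φ h) X) m a := by
  induction hh using Subgroup.closure_induction generalizing X with
  | mem y hy =>
    obtain ⟨i, j, hij, hj, rfl⟩ := hy
    rw [hφ i j hij, hurwitz_band_sq_update hij hj]
  | one => simp
  | mul a b _ _ ha hb => simp only [map_mul, Equiv.Perm.mul_apply, hb, ha]
  | inv a _ ha =>
    rw [map_inv, map_inv, Equiv.Perm.inv_eq_iff_eq, ha, ← Equiv.Perm.mul_apply, mul_inv_cancel,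
      Equiv.Perm.one_apply]

open RegularWreathProduct in
/-- The twists of the strand `m` generate a free group which acts faithfully: a word `w` translates
the base function of the entry at `m` by `w`. -/
theorem hurwitz_lift_left (hφ : ∀ i j, i < j → φ (A i j) = band i j ^ 2) (m : Fin n)
    (w : FreeGroup {i : Fin n // i < m})
    (X : Fin n → Multiplicative ℤ ≀ᵣ FreeGroup {i : Fin n // i < m}) (hm : (X m).right = 1)
    (hX : ∀ i : {i : Fin n // i < m}, (X i).right = (FreeGroup.of i)⁻¹)
    (q : FreeGroup {i : Fin n // i < m}) :
    (hurwitz n _ (φ (FreeGroup.lift (fun i : {i : Fin n // i < m} => A i m) w)) X m).left q =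
      (X m).left (w⁻¹ * q) := by
  -- In the free quotient the entry at `m` is `1`, so twists of `m` act trivially there. Thus the
  -- conditions on the right components survive along the whole word.
  have right_eq : ∀ (k : G), k ∈ strandTwists A m →
      ∀ X : Fin n → Multiplicative ℤ ≀ᵣ FreeGroup {i : Fin n // i < m}, (X m).right = 1 →
      ∀ i, (hurwitz n _ (φ k) X i).right = (X i).right := by
    intro k hk X hm i
    have h1 := hurwitz_comp (rightHom : Multiplicative ℤ ≀ᵣ FreeGroup {i : Fin n // i < m} →* _)
      (φ k) X
    rw [hurwitz_strandTwists_of_eq_one hφ hk _ hm] at h1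
    exact (congrFun h1 i).symm
  have gen : ∀ (i : {i : Fin n // i < m})
      (X : Fin n → Multiplicative ℤ ≀ᵣ FreeGroup {i : Fin n // i < m}), (X m).right = 1 →
      (∀ i : {i : Fin n // i < m}, (X i).right = (FreeGroup.of i)⁻¹) → ∀ q,
      (hurwitz n _ (φ (A i m)) X m).left q = (X m).left ((FreeGroup.of i)⁻¹ * q) := by
    intro i X hm hX q
    rw [hφ _ _ i.2, hurwitz_band_sq i.2]
    have e : hurwitzFun (i : Fin n) m (hurwitzFun (i : Fin n) m X) m =
        (X i)⁻¹ * X m * X i := by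
      simp [hurwitzFun, i.2.ne']
    rw [e]
    -- The left component of `X i` cancels because `Multiplicative ℤ` is commutative; only the
    -- translation by its right component remains.
    simp [hX, hm, mul_comm, mul_left_comm]
  have lift_mem : ∀ w, FreeGroup.lift (fun i : {i : Fin n // i < m} => A i m) w ∈
      strandTwists A m := by
    intro w
    have : (FreeGroup.lift (fun i : {i : Fin n // i < m} => A i m)).range ≤ strandTwists A m := by
      apply FreeGroup.range_lift_le
      rintro _ ⟨i, rfl⟩
      exact mem_strandTwists i.2
    exact this ⟨w, rfl⟩
  induction w using FreeGroup.induction_on generalizing X q with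
  | C1 => simp
  | of i =>
    rw [FreeGroup.lift_apply_of]
    exact gen i X hm hX q
  | inv_of i _ =>
    have hk : (A i m)⁻¹ ∈ strandTwists A m := inv_mem (mem_strandTwists i.2)
    have h1 := gen i (hurwitz n _ (φ (A i m)⁻¹) X) (by rw [right_eq _ hk X hm, hm])
      (fun j => by rw [right_eq _ hk X hm, hX]) (FreeGroup.of i * q)
    rw [← Equiv.Perm.mul_apply, ← map_mul, ← map_mul, mul_inv_cancel, map_one, map_one,
      inv_mul_cancel_left] at h1
    rw [map_inv, FreeGroup.lift_apply_of, inv_inv, ← h1]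
    rfl
  | mul a b ha hb =>
    have hk := lift_mem b
    rw [map_mul, map_mul, map_mul, Equiv.Perm.mul_apply,
      ha _ (by rw [right_eq _ hk X hm, hm]) (fun j => by rw [right_eq _ hk X hm, hX]),
      hb X hm hX, mul_inv_rev, mul_assoc]

theorem eq_one_of_mem_strandTwists (hφ : ∀ i j, i < j → φ (A i j) = band i j ^ 2) {m : Fin n}
    {k : G} (hk : k ∈ strandTwists A m)
    (h1 : ∀ (H : Type) [Group H] (X : Fin n → H), hurwitz n H (φ k) X = X) : k = 1 := by
  obtain ⟨w, rfl⟩ : ∃ w, FreeGroup.lift (fun i : {i : Fin n // i < m} => A i m) w = k := by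
    rw [← MonoidHom.mem_range, FreeGroup.range_lift_eq_closure]
    have : Set.range (fun i : {i : Fin n // i < m} => A i m) = {x | ∃ i, i < m ∧ x = A i m} := by
      ext x
      simp [eq_comm]
    rw [this]
    exact hk
  classical
  -- The entry at `m` is the delta function at `1`. A word `w` moves it to the delta function at
  -- `w`, so evaluating at `1` detects `w ≠ 1`. Entries above `m` play no role.
  let X : Fin n → Multiplicative ℤ ≀ᵣ FreeGroup {i : Fin n // i < m} := fun i =>
    if h : i < m then ⟨1, (FreeGroup.of ⟨i, h⟩)⁻¹⟩ else ⟨Pi.mulSingle 1 (Multiplicative.ofAdd 1), 1⟩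
  have key := hurwitz_lift_left hφ m w X (by simp [X]) (fun i => by simp [X, i.2]) 1
  rw [h1] at key
  by_contra hne
  have hw : w ≠ 1 := by
    rintro rfl
    exact hne (map_one _)
  simp [X, hw] at key

theorem PureRel.eq_one_of_mem_lowerTwists (hA : PureRel A)
    (hφ : ∀ i j, i < j → φ (A i j) = band i j ^ 2) (m : ℕ) (hm : m ≤ n) {x : G}
    (hx : x ∈ lowerTwists A m)
    (h1 : ∀ (H : Type) [Group H] (X : Fin n → H), hurwitz n H (φ x) X = X) : x = 1 := by
  induction m generalizing x with
  | zero =>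
    have : lowerTwists A 0 = ⊥ := by simp [lowerTwists]
    rwa [this, Subgroup.mem_bot] at hx
  | succ m ih =>
    obtain ⟨k, hk, h, hh, rfl⟩ := hA.exists_comb ⟨m, hm⟩ hx
    obtain rfl : h = 1 := by
      refine ih (by omega) hh fun H _ X => ?_
      -- With `1` at `m` the factor `k` does nothing, so `h` fixes `X` away from `m`; it never
      -- changes the entry at `m`.
      have e1 := h1 H (Function.update X ⟨m, hm⟩ 1)
      have e2 := hurwitz_lowerTwists_update hφ hh X (X ⟨m, hm⟩)
      rw [map_mul, map_mul, Equiv.Perm.mul_apply, hurwitz_lowerTwists_update hφ hh,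
        hurwitz_strandTwists_of_eq_one hφ hk _ (by simp)] at e1
      rw [Function.update_eq_self] at e2
      have e3 := congrArg (fun Y => Function.update Y ⟨m, hm⟩ (X ⟨m, hm⟩)) e1
      simp only [Function.update_idem] at e3
      rw [e2, e3, Function.update_eq_self]
    rw [mul_one] at h1 ⊢
    exact eq_one_of_mem_strandTwists hφ hk h1

/-- Pure braid relations suffice: a homomorphism to the braid group that maps a family satisfying
them to the full twists is injective on the subgroup generated by the family. -/
theorem PureRel.eq_one_of_map_eq_one (hA : PureRel A)
    (hφ : ∀ i j, i < j → φ (A i j) = band i j ^ 2) {x : G}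
    (hx : x ∈ Subgroup.closure {x | ∃ i j, i < j ∧ x = A i j}) (h1 : φ x = 1) : x = 1 := by
  refine hA.eq_one_of_mem_lowerTwists hφ n le_rfl ?_ (fun H _ X => by simp [h1])
  simpa [lowerTwists] using hx

end
theorem letter_comm {n : ℕ} (i j : Fin n) : letter i j = letter j i := by
  rcases lt_trichotomy i j with h | rfl | h
  · simp [letter, h, h.not_gt]
  · rfl
  · simp [letter, h, h.not_gt]

/-! ### Coset enumeration for products of symmetric groups -/

/-- Involutions `t i j`, one for each pair with `M i j = 1`, that multiply like transpositions. -/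
structure SwapRel {n : ℕ} (M : Matrix (Fin n) (Fin n) ℕ) {Q : Type*} [Group Q]
    (t : Fin n → Fin n → Q) : Prop where
  symm : ∀ i j, t i j = t j i
  sq : ∀ {i j}, i ≠ j → M i j = 1 → t i j * t i j = 1
  tri : ∀ {i j k}, i ≠ j → i ≠ k → j ≠ k → M i j = 1 → M i k = 1 →
    t i j * t i k = t j k * t i j
  comm : ∀ {i j k l}, i < j → k < l → i ≠ k → i ≠ l → j ≠ k → j ≠ l → M i j = 1 → M k l = 1 →
    Commute (t i j) (t k l)

/-- The subgroup generated by the `t i j` with `i < j < m`. -/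
def lowerSwaps {n : ℕ} (M : Matrix (Fin n) (Fin n) ℕ) {Q : Type*} [Group Q]
    (t : Fin n → Fin n → Q) (m : ℕ) : Subgroup Q :=
  Subgroup.closure {x | ∃ i j : Fin n, i < j ∧ j.val < m ∧ M i j = 1 ∧ x = t i j}

section
variable {n : ℕ} {M : Matrix (Fin n) (Fin n) ℕ} {Q : Type*} [Group Q] {t : Fin n → Fin n → Q}

theorem SwapRel.mem_lowerSwaps (ht : SwapRel M t) (hsymm : M.IsSymm) {i j : Fin n} {m : ℕ}
    (hij : i ≠ j) (hi : i.val < m) (hj : j.val < m) (h : M i j = 1) :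
    t i j ∈ lowerSwaps M t m := by
  rcases lt_or_gt_of_ne hij with h' | h'
  · exact Subgroup.subset_closure ⟨i, j, h', hj, h, rfl⟩
  · exact Subgroup.subset_closure ⟨j, i, h', hi, by rw [hsymm.apply, h], ht.symm i j⟩

/-- The union of the cosets of `1` and of the `t i m` is closed under right multiplication by each
generator, and the generators are involutions. Transitivity of `M i j = 1` ensures that every letter
produced by a rewriting is available. -/
theorem SwapRel.lowerSwaps_succ (ht : SwapRel M t) (hsymm : M.IsSymm)
    (htrans : ∀ i j k : Fin n, i ≠ j → j ≠ k → i ≠ k → M i j = 1 → M j k = 1 → M i k = 1)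
    (m : Fin n) {x : Q} (hx : x ∈ lowerSwaps M t (m + 1)) :
    x ∈ lowerSwaps M t m ∨
      ∃ i, i < m ∧ M i m = 1 ∧ ∃ y ∈ lowerSwaps M t m, x = y * t i m := by
  have step : ∀ x, (x ∈ lowerSwaps M t m ∨
      ∃ i, i < m ∧ M i m = 1 ∧ ∃ y ∈ lowerSwaps M t m, x = y * t i m) →
      ∀ j k : Fin n, j < k → k.val < m + 1 → M j k = 1 → (x * t j k ∈ lowerSwaps M t m ∨
      ∃ i, i < m ∧ M i m = 1 ∧ ∃ y ∈ lowerSwaps M t m, x * t j k = y * t i m) := by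
    intro x hx j k hjk hk hM
    have hM' : M k j = 1 := by rw [hsymm.apply, hM]
    rcases (Nat.lt_succ_iff.1 hk).lt_or_eq with hkm | hkm
    · have hkm' : k < m := hkm
      have hjm : j < m := hjk.trans hkm'
      rcases hx with hx | ⟨i, him, hi, y, hy, rfl⟩
      · exact Or.inl (mul_mem hx (ht.mem_lowerSwaps hsymm hjk.ne hjm hkm hM))
      right
      have shared : ∀ p, p < m → i ≠ p → M i p = 1 →
          ∃ i', i' < m ∧ M i' m = 1 ∧ ∃ y' ∈ lowerSwaps M t m, y * t i m * t i p = y' * t i' m := by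
        intro p hp hip hMp
        have hMp' : M p i = 1 := by rw [hsymm.apply, hMp]
        refine ⟨p, hp, htrans p i m hip.symm him.ne hp.ne hMp' hi, y * t i p,
          mul_mem hy (ht.mem_lowerSwaps hsymm hip him hp hMp), ?_⟩
        have h1 := ht.tri hip him.ne hp.ne hMp hi
        have h2 := ht.sq hip hMp
        rw [mul_assoc, mul_assoc]
        congr 1
        calc t i m * t i p = (t i p * t i p) * t i m * t i p := by rw [h2, one_mul]
          _ = t i p * (t i p * t i m) * t i p := by group
          _ = t i p * t p m * (t i p * t i p) := by rw [h1]; group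
          _ = _ := by rw [h2, mul_one]
      by_cases hij : i = j
      · subst hij
        exact shared k hkm' hjk.ne hM
      by_cases hik : i = k
      · subst hik
        rw [ht.symm j i]
        exact shared j hjm hij hM'
      refine ⟨i, him, hi, y * t j k, mul_mem hy (ht.mem_lowerSwaps hsymm hjk.ne hjm hkm hM), ?_⟩
      rw [mul_assoc, mul_assoc, (ht.comm him hjk hij hik hjm.ne' hkm'.ne' hi hM).eq]
    · obtain rfl : k = m := Fin.ext hkm
      rcases hx with hx | ⟨i, him, hi, y, hy, rfl⟩
      · exact Or.inr ⟨j, hjk, hM, x, hx, rfl⟩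
      by_cases hij : i = j
      · subst hij
        left
        rwa [mul_assoc, ht.sq him.ne hM, mul_one]
      · right
        have hi' : M k i = 1 := by rw [hsymm.apply, hi]
        refine ⟨i, him, hi, y * t i j, mul_mem hy (ht.mem_lowerSwaps hsymm hij him hjk
          (htrans i k j him.ne hjk.ne' hij hi hM')), ?_⟩
        rw [mul_assoc, mul_assoc, ht.symm i k, ht.symm j k, ht.tri him.ne' hjk.ne' hij hi' hM']
  induction hx using Subgroup.closure_induction_right with
  | one => exact Or.inl (one_mem _)
  | mul_right x _ y hy ih =>
    obtain ⟨j, k, hjk, hk, hM, rfl⟩ := hy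
    exact step x ih j k hjk hk hM
  | mul_inv_cancel x _ y hy ih =>
    obtain ⟨j, k, hjk, hk, hM, rfl⟩ := hy
    rw [inv_eq_of_mul_eq_one_left (ht.sq hjk.ne hM)]
    exact step x ih j k hjk hk hM

theorem apply_of_mem_lowerSwaps {θ : Q →* Equiv.Perm (Fin n)}
    (hθ : ∀ i j, i < j → M i j = 1 → θ (t i j) = Equiv.swap i j) {m : Fin n} {x : Q}
    (hx : x ∈ lowerSwaps M t m) : θ x m = m := by
  induction hx using Subgroup.closure_induction with
  | mem y hy =>
    obtain ⟨j, k, hjk, hk, hM, rfl⟩ := hy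
    have hk' : k < m := hk
    rw [hθ j k hjk hM, Equiv.swap_apply_of_ne_of_ne (hjk.trans hk').ne' hk'.ne']
  | one => simp
  | mul a b _ _ ha hb => rw [map_mul, Equiv.Perm.mul_apply, hb, ha]
  | inv a _ ha => rw [map_inv, Equiv.Perm.inv_eq_iff_eq, ha]

/-- An element `y * t i m` of a nontrivial coset sends `i` to `m`, since `y` fixes `m`. So an
element with trivial image lies in the lower subgroup, and induction applies. -/
theorem SwapRel.eq_one_of_map_eq_one (ht : SwapRel M t) (hsymm : M.IsSymm)
    (htrans : ∀ i j k : Fin n, i ≠ j → j ≠ k → i ≠ k → M i j = 1 → M j k = 1 → M i k = 1)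
    {θ : Q →* Equiv.Perm (Fin n)}
    (hθ : ∀ i j, i < j → M i j = 1 → θ (t i j) = Equiv.swap i j)
    (m : ℕ) (hm : m ≤ n) {x : Q} (hx : x ∈ lowerSwaps M t m) (h1 : θ x = 1) : x = 1 := by
  induction m generalizing x with
  | zero =>
    have : lowerSwaps M t 0 = ⊥ := by simp [lowerSwaps]
    rwa [this, Subgroup.mem_bot] at hx
  | succ m ih =>
    rcases ht.lowerSwaps_succ hsymm htrans ⟨m, hm⟩ hx with hx | ⟨i, him, hi, y, hy, rfl⟩
    · exact ih (by omega) hx h1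
    · have h2 := congrArg (fun σ : Equiv.Perm (Fin n) => σ i) h1
      simp only [map_mul, hθ i _ him hi, Equiv.Perm.mul_apply, Equiv.swap_apply_left,
        apply_of_mem_lowerSwaps hθ hy, Equiv.Perm.one_apply] at h2
      exact absurd h2 him.ne'

end
-- Full twists in a group satisfying the relations of `E_M`
/-- The conditions on the exponent matrix. -/
structure IsExponentMatrix {n : ℕ} (M : Matrix (Fin n) (Fin n) ℕ) : Prop where
  symm : M.IsSymm
  one_or_two : ∀ i j : Fin n, i ≠ j → M i j = 1 ∨ M i j = 2
  trans : ∀ i j k : Fin n, i ≠ j → j ≠ k → i ≠ k → M i j = 1 → M j k = 1 → M i k = 1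

/-- The subgroup generated by the images of the words for the full twists. -/
def fullTwists {n : ℕ} (M : Matrix (Fin n) (Fin n) ℕ) {G : Type*} [Group G]
    (f : FreeGroup (Band n) →* G) : Subgroup G :=
  Subgroup.closure {x | ∃ i j, i < j ∧ x = f (sqWord M i j)}

section
variable {n : ℕ} {M : Matrix (Fin n) (Fin n) ℕ}

theorem sqWord_of_eq_two {i j : Fin n} (h : M i j = 2) : sqWord M i j = letter i j := if_pos h

theorem sqWord_of_eq_one {i j : Fin n} (h : M i j = 1) : sqWord M i j = letter i j ^ 2 := by
  simp [sqWord, h]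

theorem exists_sqWord_eq_pow (M : Matrix (Fin n) (Fin n) ℕ) (i j : Fin n) :
    ∃ e, sqWord M i j = letter i j ^ e := by
  unfold sqWord
  split_ifs
  exacts [⟨1, (pow_one _).symm⟩, ⟨2, rfl⟩]

theorem sqWord_comm (hM : IsExponentMatrix M) (i j : Fin n) : sqWord M i j = sqWord M j i := by
  rw [sqWord, sqWord, letter_comm i j, hM.symm.apply j i]

theorem IsExponentMatrix.eq_two_of_eq_one_of_eq_two (hM : IsExponentMatrix M) {i j k : Fin n}
    (hij : i ≠ j) (hik : i ≠ k) (hjk : j ≠ k) (h1 : M i j = 1) (h2 : M i k = 2) : M j k = 2 := by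
  refine (hM.one_or_two j k hjk).resolve_left fun h => ?_
  have := hM.trans i j k hij hjk hik h1 h
  omega

theorem CyclicOrder.ne {i j k : Fin n} (h : CyclicOrder i j k) : i ≠ j ∧ i ≠ k ∧ j ≠ k := by
  unfold CyclicOrder at h
  omega

theorem cyclicOrder_or {i j k : Fin n} (hij : i ≠ j) (hik : i ≠ k) (hjk : j ≠ k) :
    CyclicOrder i j k ∨ CyclicOrder j i k := by
  unfold CyclicOrder
  omega

variable {G : Type*} [Group G] {f : FreeGroup (Band n) →* G}

theorem map_letter_comm_of_nested_or_disjoint (hf : ∀ u v, ERel M u v → f u = f v)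
    {i j k l : Fin n} (hij : i < j) (hkl : k < l)
    (h : j < k ∨ l < i ∨ (i < k ∧ l < j) ∨ (k < i ∧ j < l)) :
    Commute (f (letter i j)) (f (letter k l)) := by
  have key : ∀ {i j k l : Fin n}, ((i < j ∧ j < k ∧ k < l) ∨ (j < k ∧ k < i ∧ i < l)) →
      Commute (f (letter i l)) (f (letter j k)) := by
    intro i j k l h
    have := hf _ _ (ERel.comm i j k l h)
    rwa [map_mul, map_mul] at this
  rcases h with h | h | ⟨h, h'⟩ | ⟨h, h'⟩
  · exact (key (Or.inr ⟨hij, h, hkl⟩)).symm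
  · exact key (Or.inr ⟨hkl, h, hij⟩)
  · exact key (Or.inl ⟨h, hkl, h'⟩)
  · exact (key (Or.inl ⟨h, hij, h'⟩)).symm

theorem map_letter_comm_conj (hf : ∀ u v, ERel M u v → f u = f v)
    {i j k l : Fin n} (hij : i < j) (hjk : j < k) (hkl : k < l) :
    Commute (f (letter j l)) (f (sqWord M k l) * f (letter i k) * (f (sqWord M k l))⁻¹) := by
  have := hf _ _ (ERel.conj i j k l hij hjk hkl)
  simp only [map_mul, map_inv] at this
  exact this

/-- The triangle relation for three indices of the same class. -/
theorem map_letter_tri_of_eq_one (hM : IsExponentMatrix M) (hf : ∀ u v, ERel M u v → f u = f v)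
    {i j k : Fin n} (h : CyclicOrder i j k) (hij : M i j = 1) (hik : M i k = 1) :
    f (letter i j) * f (letter i k) = f (letter j k) * f (letter i j) := by
  obtain ⟨n1, n2, n3⟩ := h.ne
  have hji : M j i = 1 := by rw [hM.symm.apply, hij]
  have hki : M k i = 1 := by rw [hM.symm.apply, hik]
  have hjk : M j k = 1 := hM.trans j i k n1.symm n2 n3 hji hik
  have hkj : M k j = 1 := by rw [hM.symm.apply, hjk]
  have key : ∀ {p q r : Fin n}, p < q → q < r → M p q = 1 → M p r = 1 → M q r = 1 →
      f (letter p q) * f (letter p r) = f (letter q r) * f (letter p q) ∧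
      f (letter q r) * f (letter p q) = f (letter p r) * f (letter q r) := by
    intro p q r h h' h1 h2 h3
    have e1 := hf _ _ (ERel.one₁ p q r ⟨h, h'⟩ h1 h2 h3)
    have e2 := hf _ _ (ERel.one₂ p q r ⟨h, h'⟩ h1 h2 h3)
    simp only [map_mul] at e1 e2
    exact ⟨e1, e2⟩
  rcases h with ⟨h, h'⟩ | ⟨h, h'⟩ | ⟨h, h'⟩
  · exact (key h h' hij hik hjk).1
  · obtain ⟨e1, e2⟩ := key h h' hjk hji hki
    rw [letter_comm i j, letter_comm i k, ← e2, e1.symm]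
  · obtain ⟨e1, e2⟩ := key h h' hki hkj hij
    rw [letter_comm i k, letter_comm j k, e2]

theorem map_letter_mul_sqWord (hM : IsExponentMatrix M) (hf : ∀ u v, ERel M u v → f u = f v)
    {i j k : Fin n} (h : CyclicOrder i j k) (hij : M i j = 1) :
    f (letter i j) * f (sqWord M i k) = f (sqWord M j k) * f (letter i j) := by
  obtain ⟨n1, n2, n3⟩ := h.ne
  have hji : M j i = 1 := by rw [hM.symm.apply, hij]
  rcases hM.one_or_two i k n2 with hik | hik
  · have hjk : M j k = 1 := hM.trans j i k n1.symm n2 n3 hji hik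
    have e : SemiconjBy (f (letter i j)) (f (letter i k)) (f (letter j k)) :=
      map_letter_tri_of_eq_one hM hf h hij hik
    rw [sqWord_of_eq_one hik, sqWord_of_eq_one hjk, map_pow, map_pow]
    exact e.pow_right 2
  · have hjk := hM.eq_two_of_eq_one_of_eq_two n1 n2 n3 hij hik
    rw [sqWord_of_eq_two hik, sqWord_of_eq_two hjk, ← map_mul, ← map_mul]
    exact hf _ _ (ERel.mixed₁ i j k h hij hik hjk)

/-- Write `b, p, q` for the three letters. `mixed₂` makes `b`, hence `b ^ 2`, commute with `p * q`;
by `mixed₁`, `(q * b) * (b * p) = (b * p) * (q * b)`. -/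
theorem map_sqWord_cyclic (hM : IsExponentMatrix M) (hf : ∀ u v, ERel M u v → f u = f v)
    {i j k : Fin n} (h : CyclicOrder i j k) (hij : M i j = 1) (hik : M i k = 2) :
    f (sqWord M i j) * f (sqWord M i k) * f (sqWord M j k) =
        f (sqWord M j k) * f (sqWord M i j) * f (sqWord M i k) ∧
      f (sqWord M j k) * f (sqWord M i j) * f (sqWord M i k) =
        f (sqWord M i k) * f (sqWord M j k) * f (sqWord M i j) := by
  obtain ⟨n1, n2, n3⟩ := h.ne
  have hjk := hM.eq_two_of_eq_one_of_eq_two n1 n2 n3 hij hik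
  have e1 := hf _ _ (ERel.mixed₁ i j k h hij hik hjk)
  have e2 := hf _ _ (ERel.mixed₂ i j k h hij hik hjk)
  rw [sqWord_of_eq_one hij, sqWord_of_eq_two hik, sqWord_of_eq_two hjk]
  simp only [map_mul, map_pow] at e1 e2 ⊢
  generalize f (letter i j) = b at *
  generalize f (letter i k) = p at *
  generalize f (letter j k) = q at *
  have h1 : b ^ 2 * p * q = p * q * b ^ 2 := by
    calc b ^ 2 * p * q = b * (b * p * q) := by rw [pow_two]; group
      _ = b * (p * q * b) := by rw [e2]
      _ = (b * p * q) * b := by group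
      _ = p * q * b ^ 2 := by rw [e2, pow_two]; group
  have h2 : q * b ^ 2 * p = b ^ 2 * p * q := by
    calc q * b ^ 2 * p = q * b * (b * p) := by rw [pow_two]; group
      _ = b * p * (q * b) := by rw [e1]
      _ = b * (p * q * b) := by group
      _ = b ^ 2 * p * q := by rw [← e2, pow_two]; group
  exact ⟨h2.symm, h2.trans h1⟩

/-- All three products equal the cube of the common element `x * y = z * x = y * z`. -/
theorem sq_mul_sq_mul_sq {x y z : G} (h1 : x * y = z * x) (h2 : z * x = y * z) :
    x ^ 2 * y ^ 2 * z ^ 2 = z ^ 2 * x ^ 2 * y ^ 2 ∧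
      z ^ 2 * x ^ 2 * y ^ 2 = y ^ 2 * z ^ 2 * x ^ 2 := by
  have key : ∀ {x y z : G}, x * y = z * x → z * x = y * z →
      x ^ 2 * y ^ 2 * z ^ 2 = (x * y) ^ 3 := by
    intro x y z h1 h2
    calc x ^ 2 * y ^ 2 * z ^ 2 = x * (x * y) * (y * z) * z := by simp only [pow_two, mul_assoc]
      _ = x * (y * z) * (x * y) * z := by rw [← h2, ← h1]
      _ = x * y * z * x * (y * z) := by simp only [mul_assoc]
      _ = x * y * (z * x) * (y * z) := by simp only [mul_assoc]
      _ = (x * y) ^ 3 := by rw [← h2, ← h1]; simp only [pow_succ, pow_zero, one_mul]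
  rw [key h1 h2, key (h1.trans h2).symm h1, key h2 (h1.trans h2).symm, h2.symm, h1]
  exact ⟨rfl, rfl⟩

theorem pureRel_sqWord (hM : IsExponentMatrix M) (hf : ∀ u v, ERel M u v → f u = f v) :
    PureRel (fun i j => f (sqWord M i j)) := by
  have tri : ∀ {i j k : Fin n}, i < j → j < k →
      f (sqWord M i j) * f (sqWord M i k) * f (sqWord M j k) =
        f (sqWord M j k) * f (sqWord M i j) * f (sqWord M i k) ∧
      f (sqWord M j k) * f (sqWord M i j) * f (sqWord M i k) =
        f (sqWord M i k) * f (sqWord M j k) * f (sqWord M i j) := by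
    intro i j k hij hjk
    have hik := hij.trans hjk
    rcases hM.one_or_two i j hij.ne with h1 | h1
    · rcases hM.one_or_two i k hik.ne with h2 | h2
      · have h1' : M j i = 1 := by rw [hM.symm.apply, h1]
        have h3 : M j k = 1 := hM.trans j i k hij.ne' hik.ne hjk.ne h1' h2
        have e1 := hf _ _ (ERel.one₁ i j k ⟨hij, hjk⟩ h1 h2 h3)
        have e2 := hf _ _ (ERel.one₂ i j k ⟨hij, hjk⟩ h1 h2 h3)
        rw [sqWord_of_eq_one h1, sqWord_of_eq_one h2, sqWord_of_eq_one h3]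
        simp only [map_mul, map_pow] at e1 e2 ⊢
        exact sq_mul_sq_mul_sq e1 e2
      · exact map_sqWord_cyclic hM hf (Or.inl ⟨hij, hjk⟩) h1 h2
    · have h1' : M j i = 2 := by rw [hM.symm.apply, h1]
      rcases hM.one_or_two j k hjk.ne with h3 | h3
      -- The relation is invariant under cyclic rotation, so the single pair with exponent 1 may be
      -- put first.
      · have e := map_sqWord_cyclic hM hf (i := j) (j := k) (k := i)
          (Or.inr (Or.inr ⟨hij, hjk⟩)) h3 h1'
        rw [sqWord_comm hM j i, sqWord_comm hM k i] at e
        exact ⟨(e.1.trans e.2).symm, e.1⟩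
      · have h3' : M k j = 2 := by rw [hM.symm.apply, h3]
        rcases hM.one_or_two i k hik.ne with h2 | h2
        · have h2' : M k i = 1 := by rw [hM.symm.apply, h2]
          have e := map_sqWord_cyclic hM hf (i := k) (j := i) (k := j)
            (Or.inr (Or.inl ⟨hij, hjk⟩)) h2' h3'
          rw [sqWord_comm hM k i, sqWord_comm hM k j] at e
          exact ⟨e.2, (e.1.trans e.2).symm⟩
        · have e1 := hf _ _ (ERel.two₁ i j k ⟨hij, hjk⟩ h1 h2 h3)
          have e2 := hf _ _ (ERel.two₂ i j k ⟨hij, hjk⟩ h1 h2 h3)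
          rw [sqWord_of_eq_two h1, sqWord_of_eq_two h2, sqWord_of_eq_two h3]
          simp only [map_mul] at e1 e2 ⊢
          exact ⟨e1, e2⟩
  refine ⟨?_, ?_, fun h h' => (tri h h').1, fun h h' => (tri h h').2⟩
  · intro i j k l h
    obtain ⟨e, he⟩ := exists_sqWord_eq_pow M i l
    obtain ⟨e', he'⟩ := exists_sqWord_eq_pow M j k
    have := hf _ _ (ERel.comm i j k l h)
    rw [map_mul, map_mul] at this
    simp only [he, he', map_pow]
    exact Commute.pow_pow this e e'
  · intro i j k l hij hjk hkl
    obtain ⟨e, he⟩ := exists_sqWord_eq_pow M j l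
    obtain ⟨e', he'⟩ := exists_sqWord_eq_pow M i k
    simp only [he, he', map_pow]
    rw [← conj_pow]
    exact (map_letter_comm_conj hf hij hjk hkl).pow_pow e e'

theorem sqWord_mem_fullTwists (hM : IsExponentMatrix M) {i j : Fin n} (h : i ≠ j) :
    f (sqWord M i j) ∈ fullTwists M f := by
  rcases lt_or_gt_of_ne h with h | h
  · exact Subgroup.subset_closure ⟨i, j, h, rfl⟩
  · exact Subgroup.subset_closure ⟨j, i, h, by rw [sqWord_comm hM]⟩

/-- In one cyclic order the conjugate is the twist of `j, k`. In the other, the inverse conjugation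
gives this twist, and the two conjugations differ by `b_ij ^ 2`, itself a full twist. -/
theorem conj_sqWord_mem_of_shared (hM : IsExponentMatrix M) (hf : ∀ u v, ERel M u v → f u = f v)
    {i j k : Fin n} (hij : i ≠ j) (hik : i ≠ k) (hjk : j ≠ k) (h1 : M i j = 1) :
    f (letter i j) * f (sqWord M i k) * (f (letter i j))⁻¹ ∈ fullTwists M f := by
  rcases cyclicOrder_or hij hik hjk with h | h
  · rw [map_letter_mul_sqWord hM hf h h1, mul_inv_cancel_right]
    exact sqWord_mem_fullTwists hM hjk
  · have e := map_letter_mul_sqWord hM hf h (by rw [hM.symm.apply, h1])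
    have e2 : f (letter i j) * f (sqWord M i k) * (f (letter i j))⁻¹ =
        f (sqWord M i j) * f (sqWord M j k) * (f (sqWord M i j))⁻¹ := by
      rw [letter_comm j i] at e
      rw [sqWord_of_eq_one h1, map_pow, ← mul_inv_eq_iff_eq_mul.2 e]
      simp only [pow_two, mul_assoc, mul_inv_rev]
    rw [e2]
    exact mul_mem (mul_mem (sqWord_mem_fullTwists hM hij) (sqWord_mem_fullTwists hM hjk))
      (inv_mem (sqWord_mem_fullTwists hM hij))

theorem conj_sqWord_mem (hM : IsExponentMatrix M) (hf : ∀ u v, ERel M u v → f u = f v)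
    {i j k l : Fin n} (hij : i < j) (hkl : k < l) (h1 : M i j = 1) :
    f (letter i j) * f (sqWord M k l) * (f (letter i j))⁻¹ ∈ fullTwists M f := by
  have h1' : M j i = 1 := by rw [hM.symm.apply, h1]
  obtain ⟨e, he⟩ := exists_sqWord_eq_pow M k l
  by_cases hik : i = k
  · subst hik
    by_cases hjl : j = l
    · subst hjl
      rw [he, map_pow, ((Commute.refl _).pow_right e).eq, mul_inv_cancel_right, ← map_pow, ← he]
      exact sqWord_mem_fullTwists hM hij.ne
    · exact conj_sqWord_mem_of_shared hM hf hij.ne hkl.ne hjl h1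
  by_cases hil : i = l
  · subst hil
    rw [sqWord_comm hM]
    exact conj_sqWord_mem_of_shared hM hf hij.ne hik (hkl.trans hij).ne' h1
  by_cases hjk : j = k
  · subst hjk
    rw [letter_comm]
    exact conj_sqWord_mem_of_shared hM hf hij.ne' hkl.ne hil h1'
  by_cases hjl : j = l
  · subst hjl
    rw [letter_comm, sqWord_comm hM]
    exact conj_sqWord_mem_of_shared hM hf hij.ne' hjk hik h1'
  have hA := sqWord_mem_fullTwists (f := f) hM hkl.ne
  rcases (by omega : (j < k ∨ l < i ∨ (i < k ∧ l < j) ∨ (k < i ∧ j < l)) ∨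
      (i < k ∧ k < j ∧ j < l) ∨ (k < i ∧ i < l ∧ l < j)) with h | ⟨h2, h3, h4⟩ | ⟨h2, h3, h4⟩
  · have hc := (map_letter_comm_of_nested_or_disjoint hf hij hkl h).pow_right e
    rw [← map_pow, ← he] at hc
    rwa [hc.eq, mul_inv_cancel_right]
  -- The pairs cross. By relation `conj` a conjugate of the twist of `k, l` by the twist of `j, l`
  -- commutes with `b_ij`, and the conjugating twist shares an index with `b_ij`.
  · have hc : Commute (f (letter i j))
        ((f (sqWord M j l))⁻¹ * f (sqWord M k l) * f (sqWord M j l)) := by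
      have := ((map_letter_comm_conj hf h2 h3 h4).pow_left e).conj (f (sqWord M j l))⁻¹
      rw [← map_pow, ← he] at this
      simpa [mul_assoc] using this.symm
    have hn := conj_sqWord_mem_of_shared hM hf hij.ne' h4.ne hil h1'
    rw [letter_comm] at hn
    have hc' := hc.eq
    have hjl' := sqWord_mem_fullTwists (f := f) hM h4.ne
    have e1 : f (letter i j) * f (sqWord M k l) * (f (letter i j))⁻¹ =
        (f (letter i j) * f (sqWord M j l) * (f (letter i j))⁻¹) *
        ((f (letter i j) * ((f (sqWord M j l))⁻¹ * f (sqWord M k l) * f (sqWord M j l))) *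
          (f (letter i j))⁻¹) *
        (f (letter i j) * f (sqWord M j l) * (f (letter i j))⁻¹)⁻¹ := by group
    rw [e1, hc', mul_inv_cancel_right]
    exact mul_mem (mul_mem hn (mul_mem (mul_mem (inv_mem hjl') hA) hjl')) (inv_mem hn)
  · have hc : Commute (f (letter i j))
        (f (sqWord M l j) * f (sqWord M k l) * (f (sqWord M l j))⁻¹) := by
      have := (map_letter_comm_conj hf h2 h3 h4).pow_right e
      rwa [conj_pow, ← map_pow, ← he] at this
    have hn := conj_sqWord_mem_of_shared hM hf hij.ne' h4.ne' hil h1'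
    rw [letter_comm, sqWord_comm hM j l] at hn
    have hc' := hc.eq
    have hlj' := sqWord_mem_fullTwists (f := f) hM h4.ne
    have e1 : f (letter i j) * f (sqWord M k l) * (f (letter i j))⁻¹ =
        (f (letter i j) * f (sqWord M l j) * (f (letter i j))⁻¹)⁻¹ *
        ((f (letter i j) * (f (sqWord M l j) * f (sqWord M k l) * (f (sqWord M l j))⁻¹)) *
          (f (letter i j))⁻¹) *
        (f (letter i j) * f (sqWord M l j) * (f (letter i j))⁻¹) := by group
    rw [e1, hc', mul_inv_cancel_right]
    exact mul_mem (mul_mem (inv_mem hn) (mul_mem (mul_mem hlj' hA) (inv_mem hlj'))) hn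

theorem closure_map_letter (hs : Function.Surjective f) :
    Subgroup.closure {x | ∃ i j, i < j ∧ x = f (letter i j)} = ⊤ := by
  rw [eq_top_iff, ← MonoidHom.range_eq_top.2 hs, MonoidHom.range_eq_map,
    ← FreeGroup.closure_range_of, MonoidHom.map_closure]
  apply Subgroup.closure_mono
  rintro _ ⟨_, ⟨⟨⟨i, j⟩, h⟩, rfl⟩, rfl⟩
  exact ⟨i, j, h, by simp only [letter, dif_pos (show i < j from h)]⟩

theorem fullTwists_normal (hM : IsExponentMatrix M) (hf : ∀ u v, ERel M u v → f u = f v)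
    (hs : Function.Surjective f) : (fullTwists M f).Normal := by
  constructor
  intro x hx g
  suffices (∀ x ∈ fullTwists M f, g * x * g⁻¹ ∈ fullTwists M f) ∧
      ∀ x ∈ fullTwists M f, g⁻¹ * x * g ∈ fullTwists M f from this.1 x hx
  have hg : g ∈ Subgroup.closure {x | ∃ i j, i < j ∧ x = f (letter i j)} := by
    rw [closure_map_letter hs]; trivial
  induction hg using Subgroup.closure_induction with
  | mem y hy =>
    obtain ⟨i, j, hij, rfl⟩ := hy
    have hA := sqWord_mem_fullTwists (f := f) hM hij.ne
    rcases hM.one_or_two i j hij.ne with h | h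
    · have h1 : ∀ x ∈ fullTwists M f, f (letter i j) * x * (f (letter i j))⁻¹ ∈
          fullTwists M f := by
        intro x hx
        refine conj_mem_closure ?_ hx
        rintro _ ⟨k, l, hkl, rfl⟩
        exact conj_sqWord_mem hM hf hij hkl h
      refine ⟨h1, fun x hx => ?_⟩
      -- Conjugation by `b⁻¹` is conjugation by `b` followed by conjugation by `b⁻²`, and `b ^ 2` is
      -- a full twist.
      convert mul_mem (mul_mem (inv_mem hA) (h1 x hx)) hA using 1
      rw [sqWord_of_eq_one h, map_pow]
      group
    · rw [sqWord_of_eq_two h] at hA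
      exact ⟨fun x hx => mul_mem (mul_mem hA hx) (inv_mem hA),
        fun x hx => mul_mem (mul_mem (inv_mem hA) hx) hA⟩
  | one => simp
  | mul a b _ _ ha hb =>
    refine ⟨fun x hx => ?_, fun x hx => ?_⟩
    · convert ha.1 _ (hb.1 x hx) using 1; group
    · convert hb.2 _ (ha.2 x hx) using 1; group
  | inv a _ ha => exact ⟨by simpa using ha.2, by simpa using ha.1⟩

/-- An element with trivial permutation is a product of full twists. -/
theorem mem_fullTwists_of_map_eq_one (hM : IsExponentMatrix M)
    (hf : ∀ u v, ERel M u v → f u = f v) (hs : Function.Surjective f)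
    {ψ : G →* Equiv.Perm (Fin n)}
    (hψ : ∀ i j, i < j → ψ (f (letter i j)) = Equiv.swap i j ^ M i j) {x : G} (hx : ψ x = 1) :
    x ∈ fullTwists M f := by
  have hN := fullTwists_normal hM hf hs
  let q : G →* G ⧸ fullTwists M f := QuotientGroup.mk' _
  have hq : ∀ y ∈ fullTwists M f, q y = 1 := fun y hy => (QuotientGroup.eq_one_iff y).2 hy
  have hker : fullTwists M f ≤ ψ.ker := by
    rw [fullTwists, Subgroup.closure_le]
    rintro _ ⟨i, j, hij, rfl⟩
    rw [SetLike.mem_coe, MonoidHom.mem_ker]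
    rcases hM.one_or_two i j hij.ne with h | h
    · rw [sqWord_of_eq_one h, map_pow, map_pow, hψ i j hij, h, pow_one, pow_two,
        Equiv.swap_mul_self]
    · rw [sqWord_of_eq_two h, hψ i j hij, h, pow_two, Equiv.swap_mul_self]
  have sq : ∀ {i j}, i ≠ j → M i j = 1 → q (f (letter i j)) * q (f (letter i j)) = 1 := by
    intro i j hij h
    rw [← map_mul, ← map_mul, ← pow_two, ← sqWord_of_eq_one h]
    exact hq _ (sqWord_mem_fullTwists hM hij)
  have ht : SwapRel M (fun i j => q (f (letter i j))) := by
    refine ⟨fun i j => by rw [letter_comm], sq, ?_, ?_⟩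
    · intro i j k hij hik hjk h1 h2
      have h1' : M j i = 1 := by rw [hM.symm.apply, h1]
      rcases cyclicOrder_or hij hik hjk with h | h
      · have := congrArg q (map_letter_tri_of_eq_one hM hf h h1 h2)
        simpa only [map_mul] using this
      · have e := congrArg q (map_letter_tri_of_eq_one hM hf h h1'
          (hM.trans j i k hij.symm hik hjk h1' h2))
        simp only [map_mul, letter_comm j i] at e
        have s := sq hij h1
        calc q (f (letter i j)) * q (f (letter i k))
            = q (f (letter i j)) * (q (f (letter i k)) * q (f (letter i j))) *
              q (f (letter i j)) := by rw [mul_assoc, mul_assoc, s, mul_one]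
          _ = (q (f (letter i j)) * q (f (letter i j))) * q (f (letter j k)) *
              q (f (letter i j)) := by rw [← e]; simp only [mul_assoc]
          _ = _ := by rw [s, one_mul]
    · intro i j k l hij hkl hik hil hjk hjl h1 h2
      rcases (by omega : (j < k ∨ l < i ∨ (i < k ∧ l < j) ∨ (k < i ∧ j < l)) ∨
          (i < k ∧ k < j ∧ j < l) ∨ (k < i ∧ i < l ∧ l < j)) with h | ⟨h2, h3, h4⟩ | ⟨h2, h3, h4⟩
      · exact (map_letter_comm_of_nested_or_disjoint hf hij hkl h).map q
      -- The conjugating full twist dies in the quotient, so crossing letters commute there.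
      · have := (map_letter_comm_conj hf h2 h3 h4).map q
        rw [map_mul, map_mul, map_inv, hq _ (sqWord_mem_fullTwists hM h4.ne)] at this
        simpa using this.symm
      · have := (map_letter_comm_conj hf h2 h3 h4).map q
        rw [map_mul, map_mul, map_inv, hq _ (sqWord_mem_fullTwists hM h4.ne)] at this
        simpa using this
  rw [← QuotientGroup.eq_one_iff]
  refine ht.eq_one_of_map_eq_one hM.symm hM.trans (θ := QuotientGroup.lift _ ψ hker) ?_ n le_rfl
    ?_ hx
  · intro i j hij h
    change ψ (f (letter i j)) = _
    rw [hψ i j hij, h, pow_one]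
  -- Letters with exponent 2 are themselves full twists, so the quotient is generated by the letters
  -- with exponent 1.
  · have hx' : x ∈ Subgroup.closure {x | ∃ i j, i < j ∧ x = f (letter i j)} := by
      rw [closure_map_letter hs]; trivial
    have hle : Subgroup.closure {x | ∃ i j, i < j ∧ x = f (letter i j)} ≤
        (lowerSwaps M (fun i j => q (f (letter i j))) n).comap q := by
      rw [Subgroup.closure_le]
      rintro _ ⟨i, j, hij, rfl⟩
      rw [SetLike.mem_coe, Subgroup.mem_comap]
      rcases hM.one_or_two i j hij.ne with h | h
      · exact Subgroup.subset_closure ⟨i, j, hij, j.2, h, rfl⟩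
      · rw [← sqWord_of_eq_two h, hq _ (sqWord_mem_fullTwists hM hij.ne)]
        exact one_mem _
    exact hle hx'

end
-- The relations in the braid group and the presentation of `E_M`
/-- The homomorphism that maps the abstract generator `b_ij` to `a_ij ^ m_ij`. -/
def bandPow {n : ℕ} (M : Matrix (Fin n) (Fin n) ℕ) : FreeGroup (Band n) →* BraidGroup n :=
  FreeGroup.lift fun p => band p.1.1 p.1.2 ^ M p.1.1 p.1.2

section
variable {n : ℕ} {M : Matrix (Fin n) (Fin n) ℕ}

theorem band_symm (i j : Fin n) : band i j = band j i := by rw [band, band, letter_comm]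

theorem mk_eq_mk {α : Type*} {R : FreeGroup α → FreeGroup α → Prop} {u v : FreeGroup α}
    (h : R u v) : PresentedGroup.mk (relators R) u = PresentedGroup.mk (relators R) v := by
  rw [← mul_inv_eq_one, ← map_inv, ← map_mul]
  exact PresentedGroup.one_of_mem ⟨u, v, h, rfl⟩

theorem permHom_band (i j : Fin n) : permHom n (band i j) = Equiv.swap i j := by
  rw [← lift_letter]
  rfl

theorem band_commute {i j k l : Fin n} (h : (i < j ∧ j < k ∧ k < l) ∨ (j < k ∧ k < i ∧ i < l)) :
    Commute (band i l) (band j k) := by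
  have hil : i < l := by omega
  have hjk : j < k := by omega
  have key := mk_eq_mk (R := BKLRel n) (BKLRel.comm i l j k hil hjk ?_)
  · rw [map_mul, map_mul] at key
    exact key
  · simp only [Fin.lt_def] at h
    rcases h with ⟨h1, h2, h3⟩ | ⟨h1, h2, h3⟩ <;> zify at h1 h2 h3
    · have e := mul_pos (mul_pos (sub_pos.2 h1) (sub_pos.2 (h2.trans h3)))
        (mul_pos (sub_pos.2 (h1.trans h2)) (sub_pos.2 h3))
      nlinarith
    · have e := mul_pos (mul_pos (sub_pos.2 (h1.trans h2)) (sub_pos.2 (h1.trans (h2.trans h3))))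
        (mul_pos (sub_pos.2 h2) (sub_pos.2 (h2.trans h3)))
      nlinarith

theorem band_tri {i j k : Fin n} (h : CyclicOrder i j k) :
    band i j * band i k = band j k * band i j := by
  have key : ∀ {p q r : Fin n}, p < q → q < r → band p q * band p r = band q r * band p q ∧
      band q r * band p q = band p r * band q r := by
    intro p q r h h'
    have e1 := mk_eq_mk (BKLRel.tri₁ p q r h h')
    have e2 := mk_eq_mk (BKLRel.tri₂ p q r h h')
    simp only [map_mul] at e1 e2
    exact ⟨e1, e2⟩
  rcases h with ⟨h, h'⟩ | ⟨h, h'⟩ | ⟨h, h'⟩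
  · exact (key h h').1
  · obtain ⟨e1, e2⟩ := key h h'
    rw [band_symm i j, band_symm i k, ← e2, ← e1]
  · rw [band_symm i k, band_symm j k, (key h h').2]

theorem band_tri' {i j k : Fin n} (h : CyclicOrder i j k) :
    band j k * band i j = band i k * band j k := by
  have h' : CyclicOrder k i j := by unfold CyclicOrder at h ⊢; tauto
  have e := band_tri h'
  rw [band_symm k i, band_symm k j] at e
  rw [e, band_tri h]

/-- Conjugating the nested commuting pair `a_il`, `a_jk` by `a_kl` yields exactly these two
elements. -/
theorem band_commute_conj {i j k l : Fin n} (hij : i < j) (hjk : j < k) (hkl : k < l) :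
    Commute (band j l) (band k l ^ 2 * band i k * (band k l ^ 2)⁻¹) := by
  have e1 : band k l * band j k * (band k l)⁻¹ = band j l := by
    rw [mul_inv_eq_iff_eq_mul, band_symm j k, band_symm j l]
    exact band_tri (Or.inr (Or.inr ⟨hjk, hkl⟩))
  have e2 : band k l * band i k * (band k l)⁻¹ = band i l := by
    rw [mul_inv_eq_iff_eq_mul, band_symm i k, band_symm i l]
    exact band_tri (Or.inr (Or.inr ⟨hij.trans hjk, hkl⟩))
  have e3 : band k l ^ 2 * band i k * (band k l ^ 2)⁻¹ = band k l * band i l * (band k l)⁻¹ := by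
    rw [← e2]
    simp only [pow_two, mul_assoc, mul_inv_rev]
  rw [e3, ← e1]
  exact (band_commute (Or.inl ⟨hij, hjk, hkl⟩)).symm.conj _

theorem mul_sq_mul_sq {G : Type*} [Group G] {x y z : G} (h1 : x * y = z * x)
    (h2 : z * x = y * z) : x * y ^ 2 * z ^ 2 = y ^ 2 * z ^ 2 * x := by
  calc x * y ^ 2 * z ^ 2 = x * y * (y * z) * z := by simp only [pow_two, mul_assoc]
    _ = y * z * (x * y) * z := by rw [← h2, ← h1]
    _ = y * (z * x) * (y * z) := by simp only [mul_assoc]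
    _ = y * (y * z) * (z * x) := by rw [h2]
    _ = y ^ 2 * z ^ 2 * x := by simp only [pow_two, mul_assoc]

theorem bandPow_letter (hsymm : M.IsSymm) {i j : Fin n} (h : i ≠ j) :
    bandPow M (letter i j) = band i j ^ M i j := by
  rcases lt_or_gt_of_ne h with h | h
  · simp [bandPow, letter, h]
  · simp [bandPow, letter, h, h.not_gt, hsymm.apply i j, band_symm i j]

theorem bandPow_sqWord (hM : IsExponentMatrix M) {i j : Fin n} (h : i ≠ j) :
    bandPow M (sqWord M i j) = band i j ^ 2 := by
  rcases hM.one_or_two i j h with h' | h'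
  · rw [sqWord_of_eq_one h', map_pow, bandPow_letter hM.symm h, h', pow_one]
  · rw [sqWord_of_eq_two h', bandPow_letter hM.symm h, h']

theorem bandPow_eq_of_eRel (hM : IsExponentMatrix M) (u v : FreeGroup (Band n))
    (h : ERel M u v) : bandPow M u = bandPow M v := by
  have hl := fun {i j : Fin n} => bandPow_letter (i := i) (j := j) hM.symm
  cases h with
  | comm i j k l h =>
    rw [map_mul, map_mul, hl (by omega), hl (by omega)]
    exact (band_commute h).pow_pow _ _
  | conj i j k l hij hjk hkl =>
    simp only [map_mul, map_inv]
    rw [bandPow_sqWord hM hkl.ne, hl (hjk.trans hkl).ne, hl (hij.trans hjk).ne, ← conj_pow]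
    exact (band_commute_conj hij hjk hkl).pow_pow _ _
  | mixed₁ i j k h hij hik hjk =>
    obtain ⟨n1, n2, n3⟩ := h.ne
    rw [map_mul, map_mul, hl n1, hl n2, hl n3, hij, hik, hjk, pow_one]
    have : SemiconjBy (band i j) (band i k) (band j k) := band_tri h
    exact this.pow_right 2
  | mixed₂ i j k h hij hik hjk =>
    obtain ⟨n1, n2, n3⟩ := h.ne
    simp only [map_mul]
    rw [hl n1, hl n2, hl n3, hij, hik, hjk, pow_one]
    exact mul_sq_mul_sq (band_tri h) (band_tri' h)
  | two₁ i j k h hij hik hjk =>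
    simp only [map_mul]
    rw [hl h.1.ne, hl (h.1.trans h.2).ne, hl h.2.ne, hij, hik, hjk]
    exact (sq_mul_sq_mul_sq (band_tri (Or.inl h)) (band_tri' (Or.inl h))).1
  | two₂ i j k h hij hik hjk =>
    simp only [map_mul]
    rw [hl h.1.ne, hl (h.1.trans h.2).ne, hl h.2.ne, hij, hik, hjk]
    exact (sq_mul_sq_mul_sq (band_tri (Or.inl h)) (band_tri' (Or.inl h))).2
  | one₁ i j k h hij hik hjk =>
    rw [map_mul, map_mul, hl h.1.ne, hl (h.1.trans h.2).ne, hl h.2.ne, hij, hik, hjk]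
    simpa using band_tri (Or.inl h)
  | one₂ i j k h hij hik hjk =>
    rw [map_mul, map_mul, hl h.1.ne, hl (h.1.trans h.2).ne, hl h.2.ne, hij, hik, hjk]
    simpa using band_tri' (Or.inl h)

/-- The canonical homomorphism from the presented group to the braid group. -/
def toBraid (hM : IsExponentMatrix M) : EPresented M →* BraidGroup n :=
  PresentedGroup.toGroup (f := fun p => band p.1.1 p.1.2 ^ M p.1.1 p.1.2) (by
    rintro _ ⟨u, v, h, rfl⟩
    rw [map_mul, map_inv, mul_inv_eq_one]
    exact bandPow_eq_of_eRel hM u v h)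

theorem toBraid_mk (hM : IsExponentMatrix M) (w : FreeGroup (Band n)) :
    toBraid hM (PresentedGroup.mk _ w) = bandPow M w := rfl

theorem toBraid_injective (hM : IsExponentMatrix M) : Function.Injective (toBraid hM) := by
  rw [injective_iff_map_eq_one]
  intro x hx
  have hf : ∀ u v, ERel M u v → PresentedGroup.mk (relators (ERel M)) u =
      PresentedGroup.mk (relators (ERel M)) v := fun u v h => mk_eq_mk h
  refine (pureRel_sqWord hM hf).eq_one_of_map_eq_one (φ := toBraid hM) ?_ ?_ hx
  · intro i j hij
    rw [toBraid_mk, bandPow_sqWord hM hij.ne]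
  · refine mem_fullTwists_of_map_eq_one hM hf (PresentedGroup.mk_surjective _)
      (ψ := (permHom n).comp (toBraid hM)) ?_ (by simp [hx])
    intro i j hij
    rw [MonoidHom.comp_apply, toBraid_mk, bandPow_letter hM.symm hij.ne, map_pow, permHom_band]

theorem range_toBraid (hM : IsExponentMatrix M) : (toBraid hM).range = E M := by
  have h : (toBraid hM).range = (bandPow M).range := by
    ext x
    constructor
    · rintro ⟨y, rfl⟩
      obtain ⟨w, rfl⟩ := PresentedGroup.mk_surjective _ y
      exact ⟨w, rfl⟩
    · rintro ⟨w, rfl⟩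
      exact ⟨PresentedGroup.mk _ w, rfl⟩
  rw [h, bandPow, FreeGroup.range_lift_eq_closure, E]
  congr 1
  ext x
  constructor
  · rintro ⟨⟨⟨i, j⟩, h⟩, rfl⟩
    exact ⟨i, j, h, rfl⟩
  · rintro ⟨i, j, h, rfl⟩
    exact ⟨⟨⟨i, j⟩, h⟩, rfl⟩

/-! ### Pure braids and partition-preserving braids -/

theorem isExponentMatrix_one (n : ℕ) :
    IsExponentMatrix (Matrix.of fun _ _ : Fin n => (1 : ℕ)) where
  symm := rfl
  one_or_two _ _ _ := Or.inl rfl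
  trans _ _ _ _ _ _ _ _ := rfl

theorem band_sq_mem_E (hM : IsExponentMatrix M) {i j : Fin n} (h : i < j) :
    band i j ^ 2 ∈ E M := by
  have hb : band i j ^ M i j ∈ E M := Subgroup.subset_closure ⟨i, j, h, rfl⟩
  rcases hM.one_or_two i j h.ne with h' | h' <;> rw [h'] at hb
  · rw [pow_one] at hb
    exact pow_mem hb 2
  · exact hb

/-- With all exponents 1, `bandPow` is the quotient map onto the braid group, so pure braids are
products of squares `a_ij ^ 2`; these lie in every `E M`. -/
theorem ker_permHom_le_E (hM : IsExponentMatrix M) : (permHom n).ker ≤ E M := by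
  intro β hβ
  have h1 := isExponentMatrix_one n
  have hs : Function.Surjective (bandPow (Matrix.of fun _ _ : Fin n => (1 : ℕ))) := by
    have : bandPow (Matrix.of fun _ _ : Fin n => (1 : ℕ)) = PresentedGroup.mk _ := by
      ext ⟨⟨i, j⟩, h⟩
      simp [bandPow, band, letter, show i < j from h]
    rw [this]
    exact PresentedGroup.mk_surjective _
  have key := mem_fullTwists_of_map_eq_one h1 (bandPow_eq_of_eRel h1) hs (ψ := permHom n)
    (fun i j hij => by rw [bandPow_letter h1.symm hij.ne, map_pow, permHom_band]) hβ
  have hle : fullTwists (Matrix.of fun _ _ : Fin n => (1 : ℕ))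
      (bandPow (Matrix.of fun _ _ : Fin n => (1 : ℕ))) ≤ E M := by
    rw [fullTwists, Subgroup.closure_le]
    rintro _ ⟨i, j, hij, rfl⟩
    rw [bandPow_sqWord h1 hij.ne]
    exact band_sq_mem_E hM hij
  exact hle key

/-- The equivalence relation whose classes are the blocks of equal strands. -/
def IsExponentMatrix.setoid (hM : IsExponentMatrix M) : Setoid (Fin n) where
  r i j := i = j ∨ M i j = 1
  iseqv := {
    refl := fun _ => Or.inl rfl
    symm := by
      rintro i j (rfl | h)
      · exact Or.inl rfl
      · exact Or.inr (by rw [hM.symm.apply, h])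
    trans := by
      rintro i j k (rfl | h) (rfl | h')
      · exact Or.inl rfl
      · exact Or.inr h'
      · exact Or.inr h
      · by_cases hij : i = j
        · subst hij; exact Or.inr h'
        by_cases hjk : j = k
        · subst hjk; exact Or.inr h
        by_cases hik : i = k
        · exact Or.inl hik
        · exact Or.inr (hM.trans i j k hij hjk hik h h') }

theorem E_le_partitionBraids (hM : IsExponentMatrix M) : E M ≤ partitionBraids hM.setoid := by
  rw [E, Subgroup.closure_le]
  rintro _ ⟨i, j, hij, rfl⟩ k
  rw [map_pow, permHom_band]
  rcases hM.one_or_two i j hij.ne with h | h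
  · rw [h, pow_one]
    by_cases hki : k = i
    · subst hki
      rw [Equiv.swap_apply_left]
      exact Or.inr (by rw [hM.symm.apply, h])
    by_cases hkj : k = j
    · subst hkj
      rw [Equiv.swap_apply_right]
      exact Or.inr h
    · rw [Equiv.swap_apply_of_ne_of_ne hki hkj]
  · rw [h, pow_two, Equiv.swap_mul_self]
    exact Or.inl rfl

theorem mem_map_E_of_setoid (hM : IsExponentMatrix M) {σ : Equiv.Perm (Fin n)}
    (hσ : ∀ i, hM.setoid (σ i) i) : σ ∈ (E M).map (permHom n) := by
  have hswap : ∀ {i j : Fin n}, i ≠ j → M i j = 1 → Equiv.swap i j ∈ (E M).map (permHom n) := by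
    have key : ∀ {i j : Fin n}, i < j → M i j = 1 → Equiv.swap i j ∈ (E M).map (permHom n) := by
      intro i j hij h
      refine ⟨band i j ^ M i j, Subgroup.subset_closure ⟨i, j, hij, rfl⟩, ?_⟩
      rw [map_pow, permHom_band, h, pow_one]
    intro i j hij h
    rcases lt_or_gt_of_ne hij with h' | h'
    · exact key h' h
    · rw [Equiv.swap_comm]
      exact key h' (by rw [hM.symm.apply, h])
  have hle : Subgroup.closure {τ : Equiv.Perm (Fin n) | ∃ i j, i ≠ j ∧ M i j = 1 ∧
      τ = Equiv.swap i j} ≤ (E M).map (permHom n) := by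
    rw [Subgroup.closure_le]
    rintro _ ⟨i, j, hij, h, rfl⟩
    exact hswap hij h
  apply hle
  -- A permutation of finite support lies in a group generated by swaps once it moves each point
  -- within its orbit; here the swap of `σ i` and `i` is itself a generator.
  rw [mem_closure_isSwap (by rintro _ ⟨i, j, hij, -, rfl⟩; exact ⟨i, j, hij, rfl⟩)]
  refine ⟨Set.toFinite _, fun i => ?_⟩
  rcases hσ i with h | h
  · rw [h]
    exact MulAction.mem_orbit_self i
  · by_cases hi : σ i = i
    · rw [hi]
      exact MulAction.mem_orbit_self i
    · exact ⟨⟨Equiv.swap (σ i) i, Subgroup.subset_closure ⟨_, _, hi, h, rfl⟩⟩,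
        Equiv.swap_apply_right _ _⟩

theorem E_eq_partitionBraids (hM : IsExponentMatrix M) : E M = partitionBraids hM.setoid := by
  refine le_antisymm (E_le_partitionBraids hM) fun β hβ => ?_
  obtain ⟨γ, hγ, h⟩ := mem_map_E_of_setoid hM hβ
  have : γ⁻¹ * β ∈ E M := by
    apply ker_permHom_le_E hM
    rw [MonoidHom.mem_ker, map_mul, map_inv, h, inv_mul_cancel]
  simpa using mul_mem hγ this

end
end BandBraid

theorem theorem2 (n : ℕ) (M : Matrix (Fin n) (Fin n) ℕ) (hsymm : M.IsSymm)
    (hM : ∀ i j : Fin n, i ≠ j → M i j = 1 ∨ M i j = 2)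
    (htrans : ∀ i j k : Fin n, i ≠ j → j ≠ k → i ≠ k → M i j = 1 → M j k = 1 → M i k = 1) :
    (∃ φ : BandBraid.EPresented M ≃* BandBraid.E M,
      ∀ (i j : Fin n) (h : i < j),
        (φ (PresentedGroup.of ⟨(i, j), h⟩) : BandBraid.BraidGroup n) =
          BandBraid.band i j ^ M i j) ∧
    (∃ P : Setoid (Fin n), (∀ i j, P i j ↔ i = j ∨ M i j = 1) ∧
      BandBraid.E M = BandBraid.partitionBraids P) ∧
    ((∀ i j : Fin n, i ≠ j → M i j = 2) → BandBraid.E M = (BandBraid.permHom n).ker) := by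
  have hE : BandBraid.IsExponentMatrix M := ⟨hsymm, hM, htrans⟩
  refine ⟨⟨(MonoidHom.ofInjective (BandBraid.toBraid_injective hE)).trans
    (MulEquiv.subgroupCongr (BandBraid.range_toBraid hE)), fun i j h => ?_⟩,
    ⟨hE.setoid, fun i j => Iff.rfl, BandBraid.E_eq_partitionBraids hE⟩, fun h2 => ?_⟩
  · exact (BandBraid.toBraid_mk hE (FreeGroup.of ⟨(i, j), h⟩)).trans (by simp [BandBraid.bandPow])
  · refine le_antisymm (fun β hβ => ?_) (BandBraid.ker_permHom_le_E hE)
    rw [MonoidHom.mem_ker]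
    ext1 i
    rcases BandBraid.E_le_partitionBraids hE hβ i with h | h
    · exact h
    · by_contra hi
      have := h2 _ _ hi
      rw [Equiv.Perm.one_apply] at this
      omega
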